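/- **Setting.** Let $\Omega$ be a Polish space and $B_0$ a non-atomic probability measure on it. Let $\rho(s\mid\omega)\ge 0$ be jointly measurable in $s>0$, $\omega\in\Omega$, with $\int_0^\infty \min(s,1)\,\rho(s\mid\omega)\,ds<\infty$, and put $\nu(ds,d\omega)=\rho(s\mid\omega)\,ds\,B_0(d\omega)$ on $(0,\infty)\times\Omega$. Let $G_A(da\mid s)$ be a probability kernel into $\mathbb R$, $\pi_A(s)=G_A(\{a\neq 0\}\mid s)$, and assume $1-\pi_A(s)>0$ for $\nu$-almost every $(s,\omega)$. For an integer $M\ge 0$ put $\rho_M(s\mid\omega)=[1-\pi_A(s)]^M\rho(s\mid\omega)$ and assume $$\Psi(f_M)=\int_\Omega\int_0^\infty\bigl(1-[1-\pi_A(s)]^M\bigr)\rho(s\mid\omega)\,ds\,B_0(d\omega)<\infty .$$ A random measure $N$ is $\mathrm{PRM}(\nu)$ if it is a Poisson random measure with mean measure $\nu$; then $\mu(d\omega)=\int_0^\infty s\,N(ds,d\omega)$ is called $\mathrm{CRM}(\nu)$. Let $N=\sum_k\delta_{(\tau_k,\tilde\omega_k)}$ be $\mathrm{PRM}(\rho B_0)$,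 so that $\mu=\sum_k\tau_k\delta_{\tilde\omega_k}$ is $\mathrm{CRM}(\rho B_0)$. $Z_1,\dots,Z_M\mid\mu$ are iid $\mathrm{IBP}(G_A\mid\mu)$: $Z_i=\sum_k A_{i,k}\delta_{\tilde\omega_k}$, where, given all the points $(\tau_k,\tilde\omega_k)$, the variables $A_{i,k}$ are independent with laws $G_A(\cdot\mid\tau_k)$. Let $\omega_1,\dots,\omega_K$ be the distinct points $\omega$ with $Z_i(\{\omega\})\ne0$ for some $i\le M$, and $a_{i,\ell}=Z_i(\{\omega_\ell\})$. Write $$h_{i,\ell}(s)=\left[\frac{G_A(da_{i,\ell}\mid s)}{1-\pi_A(s)}\right]^{\mathbb I\{a_{i,\ell}\ne0\}},$$ that is, as a measure in $a_{i,\ell}$: unit mass at $0$, plus $G_A(da\mid s)/(1-\pi_A(s))$ on $a\neq 0$. Then $$\Lambda(da,d\omega,ds)=\rho_M(s\mid\omega)\prod_{i=1}^M h_i(s)\,ds\,B_0(d\omega),\qquad a=(a_1,\dots,a_M)\in\mathbb R^M\setminus\{0\},$$ is a measure in $(a,\omega,s)$ of finite total mass; let $L(da,d\omega)=\bigl[\int_0^\infty\rho_M(s\mid\omega)\prod_{i}h_i(s)\,ds\bigr]B_0(d\omega)$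 be its marginal in $(a,\omega)$. **Theorem 2.1.** Almost surely $K<\infty$, and the following hold. (i) The regular conditional distribution of $N$ given $Z_1,\dots,Z_M$ is the law of $N_M+\sum_{\ell=1}^K\delta_{(J_\ell,\omega_\ell)}$, where $N_M$ is $\mathrm{PRM}(\rho_MB_0)$, independent of the jumps $J_1,\dots,J_K$, which are independent, with $$\mathbb P(J_\ell\in ds)\ \propto\ [1-\pi_A(s)]^M\rho(s\mid\omega_\ell)\prod_{i=1}^Mh_{i,\ell}(s)\,ds .\tag{1}$$ For general $G_A$, (1) means that $J_\ell$ has law $\mathcal J\bigl((a_{\cdot,\ell},\omega_\ell),ds\bigr)$, where $\mathcal J$ is a probability kernel with $\Lambda(da,d\omega,ds)=L(da,d\omega)\,\mathcal J((a,\omega),ds)$. If $G_A(da\mid s)=g(a\mid s)\lambda(da)$ on $a\ne0$ for $\nu$-almost every $(s,\omega)$, with $\lambda$ $\sigma$-finite and $g$ jointly measurable, then for $L$-almost every $(a,\omega)$ the law $\mathcal J((a,\omega),\cdot)$ has the probability density on $(0,\infty)$ obtained from (1) with $h_i(s)=[g(a_i\mid s)/(1-\pi_A(s))]^{\mathbb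 I\{a_i\ne0\}}$, the normalizing integral being positive and finite. (ii) The regular conditional distribution of $\mu$ given $Z_1,\dots,Z_M$ is the law of $\mu_M+\sum_{\ell=1}^KJ_\ell\delta_{\omega_\ell}$, with $\mu_M$ a $\mathrm{CRM}(\rho_MB_0)$ independent of the jumps $J_\ell$, which are as in (i). (iii) The law of $(Z_1,\dots,Z_M)$ is $$\mathbb P(Z_1,\dots,Z_M)=e^{-\Psi(f_M)}\prod_{\ell=1}^K\left[\int_0^\infty[1-\pi_A(s)]^M\rho(s\mid\omega_\ell)\prod_{i=1}^Mh_{i,\ell}(s)\,ds\right]B_0(d\omega_\ell),$$ as a measure on the unordered finite collections $\{(a_{\cdot,\ell},\omega_\ell)\}_{\ell\le K}$: it is the image of $e^{-\Psi(f_M)}\sum_{K\ge0}\frac1{K!}L^{\otimes K}$ under $(a_{\cdot,\ell},\omega_\ell)_{\ell\le K}\mapsto\bigl(\sum_{\ell\le K}a_{i,\ell}\delta_{\omega_\ell}\bigr)_{i\le M}$. If $G_A$ has a density $g$ with respect to $\lambda$ off $0$ as in (i), then, with $h_i$ as there, $L$ has density $\int_0^\infty\rho_M(s\mid\omega)\prod_ih_i(s)\,ds$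 with respect to $(\delta_0+\lambda|_{\{a\ne0\}})^{\otimes M}(da)\,B_0(d\omega)$ on $a\neq 0$. -/

import Mathlib

open MeasureTheory ProbabilityTheory Set
open scoped ENNReal NNReal

noncomputable section

namespace LatentFeature

/-- The cylinder σ-algebra on finite signed measures: the smallest one making all the
evaluations `z ↦ z B`, `B` measurable, measurable. -/
instance signedMeasureSpace {Ω : Type*} [MeasurableSpace Ω] : MeasurableSpace (SignedMeasure Ω) :=
  ⨆ (B : Set Ω) (_ : MeasurableSet B), (borel ℝ).comap fun z => z B

/-- `N` is a Poisson random measure with mean measure `ν` on the probability space `(S, P)`: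
the counts of sets of finite `ν`-measure are Poisson, and counts of disjoint sets are independent.
(Measures carry the σ-algebra generated by the evaluations.) -/
structure IsPRM {S X : Type*} [MeasurableSpace S] [MeasurableSpace X]
    (P : Measure S) (N : S → Measure X) (ν : Measure X) : Prop where
  measurable : Measurable N
  poisson : ∀ C : Set X, MeasurableSet C → ν C ≠ ∞ →
    P.map (fun s => N s C) = (poissonMeasure (ν C).toNNReal).map (fun n : ℕ => (n : ℝ≥0∞))
  indep : ∀ (n : ℕ) (C : Fin n → Set X), (∀ i, MeasurableSet (C i)) →
    Pairwise (Function.onFun Disjoint C) → iIndepFun (fun i s => N s (C i)) P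

section Model

variable {Ω : Type*} [MeasurableSpace Ω]

/-- The mean measure `ρ(s|ω) ds B₀(dω)` on `(0,∞) × Ω`, as a measure on `ℝ × Ω`. -/
def levyMeasure (ρ : ℝ → Ω → ℝ≥0∞) (B0 : Measure Ω) : Measure (ℝ × Ω) :=
  ((volume.restrict (Ioi (0 : ℝ))).prod B0).withDensity fun p => ρ p.1 p.2

/-- `μ(dω) = ∫₀^∞ s N(ds, dω)`. -/
def crmOf (n : Measure (ℝ × Ω)) : Measure Ω :=
  (n.withDensity fun p => ENNReal.ofReal p.1).map Prod.snd

/-- `τ k, w k, A i k` represent `N, μ, Z₁, …, Z_M`, where `Z₁, …, Z_M | μ` are iid `IBP(G | μ)` and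
`μ` is `CRM(ν)`: `N = ∑ δ_(τ k, w k)` is `PRM(ν)`, `μ = ∑ τ k δ_(w k)`,
`Z i = ∑ A i k δ_(w k)` and, given all the points, the `A i k` are independent with
laws `G(· | τ k)`. The sums are over the `k` with `τ k > 0`, so that a configuration with finitely
many points is a sequence with `τ k = 0` for all the remaining `k`. -/
structure IsIBPModel {S : Type*} [MeasurableSpace S] (P : Measure S) (G : Kernel ℝ ℝ)
    [IsMarkovKernel G] (ν : Measure (ℝ × Ω)) (M : ℕ) (τ : ℕ → S → ℝ) (w : ℕ → S → Ω) (A : Fin M → ℕ → S → ℝ)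
    (N : S → Measure (ℝ × Ω)) (μ : S → Measure Ω) (Z : Fin M → S → SignedMeasure Ω) : Prop where
  measurable_τ : ∀ k, Measurable (τ k)
  measurable_w : ∀ k, Measurable (w k)
  measurable_A : ∀ i k, Measurable (A i k)
  measurable_Z : ∀ i, Measurable (Z i)
  τ_nonneg : ∀ k s, 0 ≤ τ k s
  isPRM : IsPRM P N ν
  N_eq : ∀ᵐ s ∂P, N s = Measure.sum fun k : {k : ℕ // 0 < τ k s} => Measure.dirac (τ k s, w k s)
  μ_eq : ∀ s, μ s = crmOf (N s)
  Z_eq : ∀ᵐ s ∂P, ∀ i, ∀ B : Set Ω, MeasurableSet B →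
    HasSum (fun k : {k : ℕ // 0 < τ k s} => B.indicator (fun _ => A i k s) (w k s)) (Z i s B)
  marks : ∃ κ : Kernel (ℕ → ℝ × Ω) (Fin M × ℕ → ℝ),
    (∀ x, κ x = Measure.infinitePi fun j : Fin M × ℕ => G (x j.2).1) ∧
    HasCondDistrib (fun s (j : Fin M × ℕ) => A j.1 j.2 s) (fun s k => (τ k s, w k s)) κ P

/-- `π_A(s) = P(A ≠ 0 | s)`. -/
def piA (G : Kernel ℝ ℝ) (s : ℝ) : ℝ≥0∞ := G s {0}ᶜ

/-- `ρ_M(s|ω) = [1 - π_A(s)]^M ρ(s|ω)`. -/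
def rhoM (G : Kernel ℝ ℝ) (ρ : ℝ → Ω → ℝ≥0∞) (M : ℕ) (s : ℝ) (ω : Ω) : ℝ≥0∞ :=
  (1 - piA G s) ^ M * ρ s ω

/-- `Ψ(f_M) = ∫∫ (1 - [1 - π_A(s)]^M) ρ(s|ω) ds B₀(dω)`. -/
def Psi (G : Kernel ℝ ℝ) (ρ : ℝ → Ω → ℝ≥0∞) (B0 : Measure Ω) (M : ℕ) : ℝ≥0∞ :=
  ∫⁻ p, (1 - (1 - piA G p.1) ^ M) ∂(levyMeasure ρ B0)

/-- The factor `h(s) = [G(da|s) / (1 - π_A(s))]^{1(a ≠ 0)}` as a measure in `a`: unit mass at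
`a = 0`, and `G(da|s) / (1 - π_A(s))` on `a ≠ 0`. -/
def hMeasure (G : Kernel ℝ ℝ) (s : ℝ) : Measure ℝ :=
  Measure.dirac 0 + (1 - piA G s)⁻¹ • (G s).restrict {0}ᶜ

/-- The measure `ρ_M(s|ω) ∏ᵢ h_i(s) ds B₀(dω)`, i.e.
`ρ_M(s|ω) ∏ᵢ [G(daᵢ|s) / (1 - π_A(s))]^{1(aᵢ ≠ 0)} ds B₀(dω)`, in the variables `((a, ω), s)`,
where `a = (a₁, …, a_M) ≠ 0` because a feature is observed only if some `aᵢ ≠ 0`. -/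
def featureJump (G : Kernel ℝ ℝ) (ρ : ℝ → Ω → ℝ≥0∞) (B0 : Measure Ω) (M : ℕ) :
    Measure (((Fin M → ℝ) × Ω) × ℝ) :=
  ((levyMeasure (rhoM G ρ M) B0).bind fun p =>
    (Measure.pi fun _ : Fin M => hMeasure G p.1).map fun a => ((a, p.2), p.1)).restrict
      {x | x.1.1 ≠ 0}

/-- `[∫₀^∞ ρ_M(s|ω) ∏ᵢ h_i(s) ds] B₀(dω)` as a measure in `(a, ω)`, `a ≠ 0`. -/
def featureMeasure (G : Kernel ℝ ℝ) (ρ : ℝ → Ω → ℝ≥0∞) (B0 : Measure Ω) (M : ℕ) :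
    Measure ((Fin M → ℝ) × Ω) :=
  (featureJump G ρ B0 M).map Prod.fst

/-- The kernel `J` gives the law of a jump `J_ℓ` at a feature `ω_ℓ` with values
`(a_{1,ℓ}, …, a_{M,ℓ})`:
`J((a, ω), ds) ∝ ρ_M(s|ω) ∏ᵢ h_i(s) ds`, an identity of measures in `((a, ω), s)`. -/
def IsJumpLaw (G : Kernel ℝ ℝ) (ρ : ℝ → Ω → ℝ≥0∞) (B0 : Measure Ω) (M : ℕ)
    (J : Kernel ((Fin M → ℝ) × Ω) ℝ) : Prop :=
  featureJump G ρ B0 M = (featureMeasure G ρ B0 M) ⊗ₘ J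

/-- The signed measures `zᵢ = ∑_{ℓ<K} a_{i,ℓ} δ_{ω_ℓ}`, for `x ℓ = (a_{·,ℓ}, ω_ℓ)`. -/
def assemble (M K : ℕ) (x : Fin K → (Fin M → ℝ) × Ω) (i : Fin M) : SignedMeasure Ω :=
  ∑ l, VectorMeasure.dirac (x l).2 ((x l).1 i)

/-- The right-hand side of the marginal formula,
`e^{-Ψ(f_M)} ∏_{ℓ ≤ K} [∫₀^∞ ρ_M(s|ω_ℓ) ∏ᵢ h_{i,ℓ}(s) ds] B₀(dω_ℓ)`, as a measure on the unordered
collections `{(a_{·,ℓ}, ω_ℓ) : ℓ ≤ K}`, `K = 0, 1, …` (each is counted once: `1 / K!` times the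
measure on ordered `K`-tuples), carried to the corresponding `(z₁, …, z_M)`. -/
def marginalZ (G : Kernel ℝ ℝ) (ρ : ℝ → Ω → ℝ≥0∞) (B0 : Measure Ω) (M : ℕ) :
    Measure (Fin M → SignedMeasure Ω) :=
  ENNReal.ofReal (Real.exp (-(Psi G ρ B0 M).toReal)) •
    Measure.sum fun K : ℕ => ((K.factorial : ℝ≥0∞)⁻¹) •
      (Measure.pi fun _ : Fin K => featureMeasure G ρ B0 M).map (assemble M K)

/-- The set `{ω₁, …, ω_K}` of the features exhibited by `z₁, …, z_M`. -/
def features {M : ℕ} (z : Fin M → SignedMeasure Ω) : Set Ω := {ω | ∃ i, z i {ω} ≠ 0}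

/-- The values `(a_{1,ℓ}, …, a_{M,ℓ})` at the feature `ω = ω_ℓ`, with `ω` itself. -/
def featureAt {M : ℕ} (z : Fin M → SignedMeasure Ω) (ω : Ω) : (Fin M → ℝ) × Ω :=
  (fun i => z i {ω}, ω)

/-- The law of the jumps given `z₁, …, z_M`: independent, `J_ℓ` with law `J(a_{·,ℓ}, ω_ℓ)`. -/
def jumpsLaw {M : ℕ} (J : Kernel ((Fin M → ℝ) × Ω) ℝ) [IsMarkovKernel J]
    (z : Fin M → SignedMeasure Ω) : Measure (features z → ℝ) :=
  Measure.infinitePi fun ω : features z => J (featureAt z ω)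

/-- The law of `N_M + ∑_ℓ δ_(J_ℓ, ω_ℓ)`, with `N_M` of law `R` independent of the jumps. -/
def posteriorN {M : ℕ} (R : Measure (Measure (ℝ × Ω))) (J : Kernel ((Fin M → ℝ) × Ω) ℝ)
    [IsMarkovKernel J] (z : Fin M → SignedMeasure Ω) : Measure (Measure (ℝ × Ω)) :=
  (R.prod (jumpsLaw J z)).map fun q =>
    q.1 + Measure.sum fun ω : features z => Measure.dirac (q.2 ω, (ω : Ω))

/-- The law of `μ_M + ∑_ℓ J_ℓ δ_(ω_ℓ)`, with `μ_M` of law `R` independent of the jumps. -/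
def posteriorμ {M : ℕ} (R : Measure (Measure Ω)) (J : Kernel ((Fin M → ℝ) × Ω) ℝ)
    [IsMarkovKernel J] (z : Fin M → SignedMeasure Ω) : Measure (Measure Ω) :=
  (R.prod (jumpsLaw J z)).map fun q =>
    q.1 + Measure.sum fun ω : features z => ENNReal.ofReal (q.2 ω) • Measure.dirac (ω : Ω)

/-- `Q` is, for almost every value of `X`, the conditional law of `Y` given `X`
(as a regular conditional distribution). -/
def IsPosterior {S 𝓧 𝓨 : Type*} [MeasurableSpace S] [MeasurableSpace 𝓧] [MeasurableSpace 𝓨]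
    (P : Measure S) (Y : S → 𝓨) (X : S → 𝓧) (Q : 𝓧 → Measure 𝓨) : Prop :=
  ∃ κ : Kernel 𝓧 𝓨, IsMarkovKernel κ ∧ (∀ᵐ x ∂(P.map X), κ x = Q x) ∧ HasCondDistrib Y X κ P

/-- `g(a|s)` is a density of `G(da|s)` on `a ≠ 0` with respect to `lam`, for `ν`-almost all `s`
(counting measure: discrete `A`; Lebesgue measure: `A` continuous apart from its mass at `0`). -/
def IsMarkDensity (G : Kernel ℝ ℝ) (ν : Measure (ℝ × Ω)) (lam : Measure ℝ)
    (g : ℝ → ℝ → ℝ≥0∞) : Prop :=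
  Measurable (Function.uncurry g) ∧
    ∀ᵐ p ∂ν, (G p.1).restrict {0}ᶜ = (lam.withDensity (g p.1)).restrict {0}ᶜ

open Classical in
/-- `h(s) = [g(a|s) / (1 - π_A(s))]^{1(a ≠ 0)}`. -/
def hDensity (G : Kernel ℝ ℝ) (g : ℝ → ℝ → ℝ≥0∞) (a s : ℝ) : ℝ≥0∞ :=
  if a = 0 then 1 else g s a / (1 - piA G s)

/-- `[1 - π_A(s)]^M ρ(s|ω) ∏ᵢ h_i(s)`, with `x = (a, ω)`. -/
def jumpWeight (G : Kernel ℝ ℝ) (ρ : ℝ → Ω → ℝ≥0∞) (M : ℕ) (g : ℝ → ℝ → ℝ≥0∞)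
    (x : (Fin M → ℝ) × Ω) (s : ℝ) : ℝ≥0∞ :=
  rhoM G ρ M s x.2 * ∏ i, hDensity G g (x.1 i) s

/-- `∫₀^∞ [1 - π_A(s)]^M ρ(s|ω) ∏ᵢ h_i(s) ds`. -/
def jumpNorm (G : Kernel ℝ ℝ) (ρ : ℝ → Ω → ℝ≥0∞) (M : ℕ) (g : ℝ → ℝ → ℝ≥0∞)
    (x : (Fin M → ℝ) × Ω) : ℝ≥0∞ :=
  ∫⁻ s in Ioi 0, jumpWeight G ρ M g x s

end Model

end LatentFeature

end

/-! Attach to each point $(\tau_k,\tilde\omega_k)$ of $N$ its vector of marks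
$a=(A_{1,k},\dots,A_{M,k})$. By the marking theorem (`IsIBPModel.hasPoissonLaplace_markedPoints`)
the marked points form a Poisson process with mean measure $\nu\otimes G_A^{\otimes M}$. Split it
according to whether $a=0$. The mean measure of the points with $a=0$ is $[1-\pi_A]^M\nu$, that is
$\rho_M B_0$. On $a\ne0$ the factor $[1-\pi_A]^M$ cancels the denominators of the $h_i$, so the mean
measure is $\Lambda$ (`featureJump_eq`), of finite mass $\Psi(f_M)$.

A Poisson process of finite mean measure $\Lambda$ has law $e^{-\Lambda(1)}\sum_K \Lambda^{\otimes
K}/K!$ on unordered collections. `map_markedPoints_eq` proves this together with the independence of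
the two parts, by comparing Laplace functionals, which determine the law of a random measure
(`measure_eq_of_laplaceFunctional`).

The observations depend only on the coordinates $(a,\omega)$ of the points with $a\ne0$, while $N$
consists of the unmarked points and the pairs $(s,\omega)$ of the marked ones. Disintegrating
$\Lambda=L\otimes\mathcal J$ in each factor of $\Lambda^{\otimes K}$ (`lintegral_pi_compProd`)
therefore gives independent jumps given the features (`map_observe_eq_compProd`). The first marginal
of the joint law is (iii), the conditional law is (i), and (ii) is the image of (i) under
$n\mapsto\int s\,n(ds,\cdot)$.

The conditioning is on $(Z_i)$, not on a numbered tuple. Since $B_0$ has no atoms the features are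
almost surely distinct (`pi_ae_mem_validTuples`), so $(Z_i)$ determines the tuple up to order.
Ordering the features through an embedding into $\mathbb R$ makes the correspondence injective, and
the Lusin–Souslin theorem transfers measurability from tuples to signed measures. -/

noncomputable section

namespace LatentFeature

section


/-! ### The exponential on the extended half-line -/

section ExpNeg

/-- `x ↦ e^{-x}` on `[0, ∞]`, with `e^{-∞} = 0`. -/
def expNeg (x : ℝ≥0∞) : ℝ≥0∞ := EReal.exp (-(x : EReal))

/-- `u ↦ -log u` on `[0, 1]`, with `-log 0 = ∞`. -/
def negLog (u : ℝ≥0∞) : ℝ≥0∞ := (-(ENNReal.log u)).toENNReal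

lemma expNeg_zero : expNeg 0 = 1 := by simp [expNeg]

lemma expNeg_ofReal {x : ℝ} (hx : 0 ≤ x) :
    expNeg (ENNReal.ofReal x) = ENNReal.ofReal (Real.exp (-x)) := by
  rw [expNeg, EReal.coe_ennreal_ofReal, max_eq_left hx, ← EReal.coe_neg, EReal.exp_coe]

lemma expNeg_add (x y : ℝ≥0∞) : expNeg (x + y) = expNeg x * expNeg y := by
  rw [expNeg, EReal.coe_ennreal_add, EReal.neg_add (by simp) (by simp), sub_eq_add_neg,
    EReal.exp_add, expNeg, expNeg]

lemma expNeg_le_one (x : ℝ≥0∞) : expNeg x ≤ 1 := by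
  rw [expNeg, EReal.exp_le_one_iff, EReal.neg_le_zero]
  exact EReal.coe_ennreal_nonneg x

lemma expNeg_ne_top (x : ℝ≥0∞) : expNeg x ≠ ∞ := ((expNeg_le_one x).trans_lt (by simp)).ne

lemma continuous_expNeg : Continuous expNeg :=
  ENNReal.continuous_exp.comp (continuous_neg.comp continuous_coe_ennreal_ereal)

@[fun_prop]
lemma measurable_expNeg : Measurable expNeg := continuous_expNeg.measurable

/-- Injectivity includes the point $\infty$; this is what lets the exponentials separate points of
$[0,\infty]^\iota$. -/
lemma expNeg_injective : Function.Injective expNeg := by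
  intro x y h
  have := EReal.exp_strictMono.injective h
  simpa using this

lemma expNeg_antitone : Antitone expNeg := fun x y h => by
  rw [expNeg, expNeg, EReal.exp_le_exp_iff, EReal.neg_le_neg_iff]
  exact_mod_cast h

lemma expNeg_sum {ι : Type*} (s : Finset ι) (f : ι → ℝ≥0∞) :
    expNeg (∑ i ∈ s, f i) = ∏ i ∈ s, expNeg (f i) := by
  classical
  induction s using Finset.induction_on with
  | empty => simp [expNeg_zero]
  | insert a s ha ih => rw [Finset.sum_insert ha, Finset.prod_insert ha, expNeg_add, ih]

lemma expNeg_nat_mul (n : ℕ) (x : ℝ≥0∞) : expNeg (n * x) = expNeg x ^ n := by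
  have := expNeg_sum (Finset.range n) (fun _ => x)
  simpa using this

/-- Any $[0,1]$-valued factor, zero included, becomes the exponential of a test function, so
products over points become Laplace functionals. -/
lemma expNeg_negLog {u : ℝ≥0∞} (hu : u ≤ 1) : expNeg (negLog u) = u := by
  rw [expNeg, negLog, EReal.coe_toENNReal, neg_neg, ENNReal.exp_log]
  simpa [EReal.neg_nonneg] using hu

@[fun_prop]
lemma measurable_negLog : Measurable negLog := by
  unfold negLog
  exact (ENNReal.measurable_log.neg).ereal_toENNReal

/-- `∏ e^{-x k}` over the first `n` factors tends to `e^{-∑ x k}`. -/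
lemma tendsto_prod_expNeg (f : ℕ → ℝ≥0∞) :
    Filter.Tendsto (fun n => ∏ k ∈ Finset.range n, expNeg (f k)) Filter.atTop
      (nhds (expNeg (∑' k, f k))) := by
  simp_rw [← expNeg_sum]
  exact (continuous_expNeg.tendsto _).comp ENNReal.summable.hasSum.tendsto_sum_nat

end ExpNeg

/-! ### Laplace functionals determine laws of random measures -/

section Uniqueness

open BoundedContinuousFunction in
/-- The coordinate `x ↦ e^{-x i}` as a bounded continuous function on `[0, ∞]^ι`. -/
def expNegCoord {ι : Type*} (i : ι) : (ι → ℝ≥0∞) →ᵇ ℝ :=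
  BoundedContinuousFunction.ofNormedAddCommGroup (fun x => (expNeg (x i)).toReal)
    (ENNReal.continuousOn_toReal.comp_continuous
      (continuous_expNeg.comp (continuous_apply i)) fun x => expNeg_ne_top _) 1 (fun x => by
        rw [Real.norm_of_nonneg ENNReal.toReal_nonneg]
        exact ENNReal.toReal_le_of_le_ofReal zero_le_one (by simpa using expNeg_le_one _))

/-- Finite measures on `[0, ∞]^ι` are determined by their Laplace transforms at integer points. -/
lemma measure_eq_of_laplace {ι : Type*} [Fintype ι] {μ ν : Measure (ι → ℝ≥0∞)}
    [IsFiniteMeasure μ] [IsFiniteMeasure ν]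
    (h : ∀ t : ι → ℕ, ∫⁻ x, expNeg (∑ i, t i * x i) ∂μ = ∫⁻ x, expNeg (∑ i, t i * x i) ∂ν) :
    μ = ν := by
  classical
  let s : Set (BoundedContinuousFunction (ι → ℝ≥0∞) ℝ) := range expNegCoord
  let A : StarSubalgebra ℝ (BoundedContinuousFunction (ι → ℝ≥0∞) ℝ) :=
    { Algebra.adjoin ℝ s with
      star_mem' := fun {a} ha => by
        have : star a = a := by ext x; simp
        rwa [this] }
  -- Monomials in the coordinates $e^{-x_i}$ are exactly the exponentials with integer exponents, so
  -- the hypothesis at integer points covers a spanning set of the algebra.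
  have hmono : ∀ g ∈ Submonoid.closure s, ∃ t : ι → ℕ, ∀ x,
      g x = (expNeg (∑ i, t i * x i)).toReal := by
    intro g hg
    induction hg using Submonoid.closure_induction with
    | mem g hg =>
      obtain ⟨i, rfl⟩ := hg
      refine ⟨Pi.single i 1, fun x => ?_⟩
      simp [expNegCoord, Pi.single_apply]
    | one => exact ⟨0, fun x => by simp [expNeg_zero]⟩
    | mul g g' _ _ hg hg' =>
      obtain ⟨t, ht⟩ := hg
      obtain ⟨t', ht'⟩ := hg'
      refine ⟨t + t', fun x => ?_⟩
      simp [ht, ht', add_mul, Finset.sum_add_distrib, expNeg_add]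
  refine ext_of_forall_mem_subalgebra_integral_eq_of_polish (𝕜 := ℝ) (A := A) ?_ ?_
  · intro x y hxy
    obtain ⟨i, hi⟩ := Function.ne_iff.mp hxy
    refine ⟨expNegCoord i, ⟨_, ⟨expNegCoord i, Algebra.subset_adjoin ⟨i, rfl⟩, rfl⟩, rfl⟩, ?_⟩
    intro hc
    apply hi
    apply expNeg_injective
    exact (ENNReal.toReal_eq_toReal_iff' (expNeg_ne_top _) (expNeg_ne_top _)).mp hc
  · intro g hg
    replace hg : g ∈ Algebra.adjoin ℝ s := hg
    rw [← Subalgebra.mem_toSubmodule, Algebra.adjoin_eq_span] at hg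
    induction hg using Submodule.span_induction with
    | mem g hg =>
      obtain ⟨t, ht⟩ := hmono g hg
      simp_rw [ht]
      have hm : Measurable fun x : ι → ℝ≥0∞ => expNeg (∑ i, t i * x i) := by fun_prop
      rw [integral_toReal hm.aemeasurable (.of_forall fun x => (expNeg_ne_top _).lt_top),
        integral_toReal hm.aemeasurable (.of_forall fun x => (expNeg_ne_top _).lt_top), h]
    | zero => simp
    | add g g' _ _ hg hg' =>
      simp only [BoundedContinuousFunction.coe_add, Pi.add_apply]
      rw [integral_add (g.integrable _) (g'.integrable _), hg, hg',
        integral_add (g.integrable _) (g'.integrable _)]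
    | smul c g _ hg =>
      simp only [BoundedContinuousFunction.coe_smul]
      rw [integral_smul, integral_smul, hg]

variable {X : Type*} [MeasurableSpace X]

/-- A finite law on the space of measures is determined by its Laplace functional. -/
lemma measure_eq_of_laplaceFunctional {μ ν : Measure (Measure X)}
    [IsFiniteMeasure μ] [IsFiniteMeasure ν]
    (h : ∀ f : X → ℝ≥0∞, Measurable f →
      ∫⁻ n, expNeg (∫⁻ x, f x ∂n) ∂μ = ∫⁻ n, expNeg (∫⁻ x, f x ∂n) ∂ν) :
    μ = ν := by
  let ev : Measure X → ({C : Set X // MeasurableSet C} → ℝ≥0∞) := fun n C => n C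
  have hev : Measurable ev := measurable_pi_lambda _ fun C => Measure.measurable_coe C.2
  -- The σ-algebra is pulled back from the evaluations, so it suffices to compare the laws of the
  -- evaluation family, and these are determined by their finite-dimensional marginals.
  have hcomap : (Measure.instMeasurableSpace : MeasurableSpace (Measure X)) =
      MeasurableSpace.comap ev inferInstance := by
    refine le_antisymm ?_ hev.comap_le
    refine iSup₂_le fun C hC => ?_
    rintro _ ⟨B, hB, rfl⟩
    exact ⟨(fun x => x ⟨C, hC⟩) ⁻¹' B, measurable_pi_apply _ hB, rfl⟩
  have hmap : μ.map ev = ν.map ev := by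
    refine IsProjectiveLimit.unique (P := fun I => (μ.map ev).map I.restrict) (fun I => rfl) ?_
    intro I
    change (ν.map ev).map I.restrict = (μ.map ev).map I.restrict
    symm
    apply measure_eq_of_laplace
    intro t
    have hm : Measurable fun x : (i : I) → ℝ≥0∞ => expNeg (∑ i, t i * x i) := by fun_prop
    have hr : Measurable (I.restrict (π := fun _ : {C : Set X // MeasurableSet C} => ℝ≥0∞)) :=
      Finset.measurable_restrict I
    rw [Measure.map_map hr hev, Measure.map_map hr hev, lintegral_map hm (hr.comp hev),
      lintegral_map hm (hr.comp hev)]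
    simp only [Function.comp_apply]
    -- A combination of evaluations is the integral of a combination of indicators, so the Laplace
    -- transform of a marginal is a value of the Laplace functional.
    have key : ∀ n : Measure X, (∑ i : I, (t i : ℝ≥0∞) * I.restrict (ev n) i) =
        ∫⁻ x, ∑ i : I, (t i : ℝ≥0∞) * (i.1.1).indicator 1 x ∂n := by
      intro n
      rw [lintegral_finsetSum _ fun i _ => (measurable_one.indicator i.1.2).const_mul _]
      refine Finset.sum_congr rfl fun i _ => ?_
      rw [lintegral_const_mul _ (measurable_one.indicator i.1.2), lintegral_indicator_one i.1.2]
      rfl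
    simp_rw [key]
    exact h _ (Finset.measurable_sum _ fun i _ => (measurable_one.indicator i.1.2).const_mul _)
  ext B hB
  obtain ⟨B', hB', rfl⟩ : MeasurableSet[MeasurableSpace.comap ev inferInstance] B := hcomap ▸ hB
  rw [← Measure.map_apply hev hB', hmap, Measure.map_apply hev hB']

end Uniqueness

/-- The integral of a product of functions of one coordinate each. -/
lemma lintegral_pi_prod {n : ℕ} {X : Fin n → Type*} [∀ i, MeasurableSpace (X i)]
    (μ : ∀ i, Measure (X i)) [∀ i, SigmaFinite (μ i)]
    {f : ∀ i, X i → ℝ≥0∞} (hf : ∀ i, Measurable (f i)) :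
    ∫⁻ x, ∏ i, f i (x i) ∂(Measure.pi μ) = ∏ i, ∫⁻ y, f i y ∂(μ i) := by
  induction n with
  | zero => simp
  | succ n ih =>
    rw [← ((measurePreserving_piFinSuccAbove μ 0).symm).map_eq,
      MeasureTheory.lintegral_map_equiv]
    simp_rw [Fin.prod_univ_succ]
    have : ∀ x : X 0 × ((j : Fin n) → X (Fin.succAbove 0 j)),
        f 0 ((MeasurableEquiv.piFinSuccAbove X 0).symm x 0) *
          ∏ i : Fin n, f i.succ ((MeasurableEquiv.piFinSuccAbove X 0).symm x i.succ) =
        f 0 x.1 * ∏ i : Fin n, f i.succ (x.2 i) := fun x => rfl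
    simp_rw [this]
    rw [← ih (X := fun i => X i.succ) (fun i => μ i.succ) (f := fun i => f i.succ)
        fun i => hf i.succ]
    exact lintegral_prod_mul (μ := μ 0) (ν := Measure.pi fun i : Fin n => μ i.succ)
      (hf 0).aemeasurable (Finset.measurable_prod Finset.univ fun (i : Fin n) _ =>
        (hf i.succ).comp (measurable_pi_apply i)).aemeasurable

end

/-! ### Poisson random measures and their Laplace functional -/

section


lemma tsum_inv_factorial_mul_pow {x : ℝ≥0∞} (hx : x ≠ ∞) :
    ∑' n : ℕ, (n.factorial : ℝ≥0∞)⁻¹ * x ^ n = ENNReal.ofReal (Real.exp x.toReal) := by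
  have hterm : ∀ n : ℕ, (n.factorial : ℝ≥0∞)⁻¹ * x ^ n =
      ENNReal.ofReal (x.toReal ^ n / n.factorial) := by
    intro n
    rw [div_eq_inv_mul, ENNReal.ofReal_mul (by positivity), ENNReal.ofReal_pow (by positivity),
      ENNReal.ofReal_toReal hx, ENNReal.ofReal_inv_of_pos (by positivity), ENNReal.ofReal_natCast]
  simp_rw [hterm]
  have hs := NormedSpace.expSeries_div_hasSum_exp x.toReal
  rw [← ENNReal.ofReal_tsum_of_nonneg (fun n => by positivity) hs.summable, hs.tsum_eq,
    Real.exp_eq_exp_ℝ]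

/-- Subtraction is truncated in $[0,\infty]$; the two hypotheses make it the real one. -/
lemma expNeg_mul_exp {a b : ℝ≥0∞} (ha : a ≠ ∞) (hab : b ≤ a) :
    expNeg a * ENNReal.ofReal (Real.exp b.toReal) = expNeg (a - b) := by
  have hb : b ≠ ∞ := (hab.trans_lt ha.lt_top).ne
  rw [← ENNReal.ofReal_toReal (ENNReal.sub_ne_top ha (b := b)), ← ENNReal.ofReal_toReal ha,
    expNeg_ofReal ENNReal.toReal_nonneg, expNeg_ofReal ENNReal.toReal_nonneg,
    ← ENNReal.ofReal_mul (Real.exp_pos _).le, ← Real.exp_add, ENNReal.ofReal_toReal ha,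
    ENNReal.toReal_sub_of_le hab ha]
  congr 2
  ring

/-- The Laplace transform of the Poisson law. -/
lemma lintegral_expNeg_poisson (r : ℝ≥0) (c : ℝ≥0∞) :
    ∫⁻ n : ℕ, expNeg (c * n) ∂(poissonMeasure r) = expNeg ((1 - expNeg c) * r) := by
  have hle : expNeg c * r ≤ r := by
    simpa using mul_le_mul_left (expNeg_le_one c) (r : ℝ≥0∞)
  rw [ENNReal.sub_mul fun _ _ => ENNReal.coe_ne_top, one_mul,
    ← expNeg_mul_exp ENNReal.coe_ne_top hle,
    ← tsum_inv_factorial_mul_pow (hle.trans_lt ENNReal.coe_lt_top).ne, ← ENNReal.tsum_mul_left,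
    lintegral_countable']
  refine tsum_congr fun n => ?_
  rw [poissonMeasure_singleton, mul_comm c, expNeg_nat_mul, mul_div_assoc,
    ENNReal.ofReal_mul (Real.exp_pos _).le, div_eq_inv_mul, ENNReal.ofReal_mul (by positivity),
    ENNReal.ofReal_pow (by positivity), ENNReal.ofReal_inv_of_pos (by positivity),
    ENNReal.ofReal_natCast, ENNReal.ofReal_coe_nnreal, ← expNeg_ofReal (by positivity),
    ENNReal.ofReal_coe_nnreal, mul_pow]
  ring

variable {S X : Type*} [MeasurableSpace S] [MeasurableSpace X]

/-- The Laplace functional of `N` is that of a Poisson random measure with mean measure `ν`. -/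
def HasPoissonLaplace (P : Measure S) (N : S → Measure X) (ν : Measure X) : Prop :=
  ∀ f : X → ℝ≥0∞, Measurable f →
    ∫⁻ s, expNeg (∫⁻ x, f x ∂(N s)) ∂P = expNeg (∫⁻ x, (1 - expNeg (f x)) ∂ν)

/-- The level sets of $f$ are disjoint, so their counts are independent Poisson variables and the
expectation factorizes. The level $0$ may have infinite mass, as it contributes the factor $1$. -/
lemma IsPRM.laplace_simpleFunc {P : Measure S} {N : S → Measure X} {ν : Measure X}
    (h : IsPRM P N ν) (f : SimpleFunc X ℝ≥0∞) (hf : ∀ v, v ≠ 0 → ν (f ⁻¹' {v}) ≠ ∞) :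
    ∫⁻ s, expNeg (∫⁻ x, f x ∂(N s)) ∂P = expNeg (∫⁻ x, (1 - expNeg (f x)) ∂ν) := by
  let C : f.range → Set X := fun v => f ⁻¹' {v.1}
  have hC : ∀ v, MeasurableSet (C v) := fun v => f.measurableSet_preimage _
  have hind : iIndepFun (fun v s => N s (C v)) P := by
    let e := f.range.equivFin
    have := h.indep _ (fun i => C (e.symm i)) (fun i => hC _) (fun i j hij => by
      refine Disjoint.preimage f ?_
      rw [disjoint_singleton]
      exact fun hc => hij (e.symm.injective (Subtype.ext hc)))
    simpa using this.precomp e.injective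
  have hmeas : ∀ v, Measurable fun s => N s (C v) := fun v =>
    (Measure.measurable_coe (hC v)).comp h.measurable
  have h1 : ∀ s, expNeg (∫⁻ x, f x ∂(N s)) = ∏ v : f.range, expNeg (v.1 * N s (C v)) := by
    intro s
    rw [SimpleFunc.lintegral_eq_lintegral, SimpleFunc.lintegral, expNeg_sum,
      ← Finset.prod_coe_sort]
  simp_rw [h1]
  rw [lintegral_prod_eq_prod_lintegral_of_indepFun Finset.univ
    (fun (v : f.range) s => expNeg (v.1 * N s (C v)))
    (hind.comp (fun v x => expNeg (v.1 * x)) fun v => by fun_prop) fun v => by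
      have := hmeas v; fun_prop]
  have h2 : ∫⁻ x, (1 - expNeg (f x)) ∂ν = ∑ v : f.range, (1 - expNeg v.1) * ν (C v) := by
    have := SimpleFunc.map_lintegral (fun v => 1 - expNeg v) f (μ := ν)
    rw [← SimpleFunc.lintegral_eq_lintegral, ← Finset.sum_coe_sort] at this
    exact this
  rw [h2, expNeg_sum]
  refine Finset.prod_congr rfl fun v _ => ?_
  have hmap : ∫⁻ s, expNeg (v.1 * N s (C v)) ∂P =
      ∫⁻ y, expNeg (v.1 * y) ∂(P.map fun s => N s (C v)) := by
    rw [lintegral_map (by fun_prop) (hmeas v)]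
  by_cases hv : v.1 = 0
  · have := hind.isProbabilityMeasure
    simp [hv, expNeg_zero]
  · have hfin := hf v.1 hv
    rw [hmap, h.poisson _ (hC v) hfin, lintegral_map (by fun_prop) (by fun_prop),
      lintegral_expNeg_poisson, ENNReal.coe_toNNReal hfin]

/-- A Poisson random measure with σ-finite mean measure has the Poisson Laplace functional. -/
lemma IsPRM.hasPoissonLaplace {P : Measure S} [IsProbabilityMeasure P] {N : S → Measure X}
    {ν : Measure X} [SigmaFinite ν] (h : IsPRM P N ν) : HasPoissonLaplace P N ν := by
  intro f hf
  -- Cutting the simple approximations off outside spanning sets gives every nonzero level finite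
  -- mass and still increases to $f$.
  let g : ℕ → SimpleFunc X ℝ≥0∞ := fun n =>
    (SimpleFunc.eapprox f n).restrict (spanningSets ν n)
  have hg : ∀ n x, g n x = (spanningSets ν n).indicator (SimpleFunc.eapprox f n) x := fun n x =>
    SimpleFunc.restrict_apply _ (measurableSet_spanningSets ν n) x
  have hmono : ∀ x, Monotone fun n => g n x := by
    intro x m n hmn
    simp only [hg]
    by_cases hx : x ∈ spanningSets ν m
    · rw [indicator_of_mem hx, indicator_of_mem (monotone_spanningSets ν hmn hx)]
      exact SimpleFunc.monotone_eapprox f hmn x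
    · simp [hx]
  have hlim : ∀ x, Filter.Tendsto (fun n => g n x) Filter.atTop (nhds (f x)) := by
    intro x
    refine (SimpleFunc.tendsto_eapprox hf x).congr' ?_
    obtain ⟨m, hm⟩ := mem_iUnion.mp ((iUnion_spanningSets ν).symm ▸ mem_univ x)
    filter_upwards [Filter.eventually_ge_atTop m] with n hn
    rw [hg, indicator_of_mem (monotone_spanningSets ν hn hm)]
  have hgfin : ∀ n v, v ≠ 0 → ν (g n ⁻¹' {v}) ≠ ∞ := by
    intro n v hv
    refine ((measure_mono ?_).trans_lt (measure_spanningSets_lt_top ν n)).ne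
    intro x hx
    by_contra hc
    apply hv
    have : g n x = v := hx
    rw [← this, hg, indicator_of_notMem hc]
  have hL : Filter.Tendsto (fun n => ∫⁻ s, expNeg (∫⁻ x, g n x ∂(N s)) ∂P) Filter.atTop
      (nhds (∫⁻ s, expNeg (∫⁻ x, f x ∂(N s)) ∂P)) := by
    refine tendsto_lintegral_of_dominated_convergence (fun _ => 1) (fun n => ?_)
      (fun n => .of_forall fun s => expNeg_le_one _) (by simp) (.of_forall fun s => ?_)
    · exact measurable_expNeg.comp
        ((Measure.measurable_lintegral (g n).measurable).comp h.measurable)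
    · exact (continuous_expNeg.tendsto _).comp (lintegral_tendsto_of_tendsto_of_monotone
        (fun n => (g n).measurable.aemeasurable) (.of_forall hmono) (.of_forall hlim))
  have hR : Filter.Tendsto (fun n => expNeg (∫⁻ x, (1 - expNeg (g n x)) ∂ν)) Filter.atTop
      (nhds (expNeg (∫⁻ x, (1 - expNeg (f x)) ∂ν))) := by
    refine (continuous_expNeg.tendsto _).comp (lintegral_tendsto_of_tendsto_of_monotone
        (fun n => ?_) (.of_forall fun x m n hmn => ?_) (.of_forall fun x => ?_))
    · have := (g n).measurable
      fun_prop
    · exact tsub_le_tsub_left (expNeg_antitone (hmono x hmn)) 1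
    · exact ENNReal.Tendsto.sub tendsto_const_nhds ((continuous_expNeg.tendsto _).comp (hlim x))
        (Or.inl (by simp))
  refine tendsto_nhds_unique hL (hR.congr fun n => ?_)
  exact (h.laplace_simpleFunc (g n) (hgfin n)).symm

/-- Finite measures on `[0, ∞]` are determined by their Laplace transforms at integers. -/
lemma measure_eq_of_laplace_one {μ ν : Measure ℝ≥0∞} [IsFiniteMeasure μ] [IsFiniteMeasure ν]
    (h : ∀ t : ℕ, ∫⁻ x, expNeg (t * x) ∂μ = ∫⁻ x, expNeg (t * x) ∂ν) : μ = ν := by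
  let e := MeasurableEquiv.funUnique Unit ℝ≥0∞
  refine e.symm.map_measurableEquiv_injective (measure_eq_of_laplace fun t => ?_)
  rw [lintegral_map_equiv, lintegral_map_equiv]
  simpa [e] using h (t ())

lemma lintegral_expNeg_mul_indicator {C : Set X} (hC : MeasurableSet C) (t : ℝ≥0∞)
    (ν : Measure X) :
    ∫⁻ x, (1 - expNeg (t * C.indicator 1 x)) ∂ν = (1 - expNeg t) * ν C := by
  rw [← lintegral_indicator_const hC]
  refine lintegral_congr fun x => ?_
  by_cases hx : x ∈ C <;> simp [hx, expNeg_zero]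

/-- Testing against $t1_C$ gives the Poisson transform of one count; testing against $\sum_i
t_i1_{C_i}$ with disjoint $C_i$ gives the product of the individual transforms, hence independence.
-/
lemma HasPoissonLaplace.isPRM {P : Measure S} [IsProbabilityMeasure P] {N : S → Measure X}
    {ν : Measure X} (hN : Measurable N) (h : HasPoissonLaplace P N ν) : IsPRM P N ν := by
  have hev : ∀ C, MeasurableSet C → Measurable fun s => N s C := fun C hC =>
    (Measure.measurable_coe hC).comp hN
  have hone : ∀ C, MeasurableSet C → ∀ t : ℕ,
      ∫⁻ s, expNeg (t * N s C) ∂P = expNeg ((1 - expNeg t) * ν C) := by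
    intro C hC t
    rw [← lintegral_expNeg_mul_indicator hC,
      ← h _ ((measurable_one.indicator hC).const_mul _)]
    simp_rw [lintegral_const_mul _ (measurable_one.indicator hC), lintegral_indicator_one hC]
  refine ⟨hN, fun C hC hfin => ?_, fun n C hC hd => ?_⟩
  · have := Measure.isProbabilityMeasure_map (μ := P) (hev C hC).aemeasurable
    have := Measure.isProbabilityMeasure_map (μ := poissonMeasure (ν C).toNNReal)
      (f := fun n : ℕ => (n : ℝ≥0∞)) (by fun_prop)
    refine measure_eq_of_laplace_one fun t => ?_
    rw [lintegral_map (by fun_prop) (hev C hC), lintegral_map (by fun_prop) (by fun_prop),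
      lintegral_expNeg_poisson, ENNReal.coe_toNNReal hfin, hone C hC]
  · have hp := fun i => Measure.isProbabilityMeasure_map (μ := P) (hev (C i) (hC i)).aemeasurable
    rw [iIndepFun_iff_map_fun_eq_pi_map fun i => (hev (C i) (hC i)).aemeasurable]
    have := Measure.isProbabilityMeasure_map (μ := P)
      (measurable_pi_lambda (fun s i => N s (C i)) fun i => hev (C i) (hC i)).aemeasurable
    refine measure_eq_of_laplace fun t => ?_
    rw [lintegral_map (by fun_prop) (measurable_pi_lambda _ fun i => hev (C i) (hC i))]
    simp_rw [expNeg_sum]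
    rw [lintegral_pi_prod (fun i => P.map fun s => N s (C i))
      (f := fun i y => expNeg (t i * y)) fun i => by fun_prop]
    have hR : ∀ i, ∫⁻ y, expNeg (t i * y) ∂(P.map fun s => N s (C i)) =
        expNeg ((1 - expNeg (t i)) * ν (C i)) := fun i => by
      rw [lintegral_map (by fun_prop) (hev _ (hC i)), hone _ (hC i)]
    simp_rw [hR, ← expNeg_sum, ← lintegral_expNeg_mul_indicator (hC _)]
    have hm : ∀ i, Measurable fun x => (t i : ℝ≥0∞) * (C i).indicator (1 : X → ℝ≥0∞) x :=
      fun i => (measurable_one.indicator (hC i)).const_mul _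
    rw [← lintegral_finsetSum _ fun i _ => by have := hm i; fun_prop]
    -- By disjointness at most one term is nonzero at each point, so $1-e^{-\cdot}$ is additive
    -- here.
    have hpt : ∀ x, ∑ i, (1 - expNeg (t i * (C i).indicator 1 x)) =
        1 - expNeg (∑ i, t i * (C i).indicator 1 x) := by
      intro x
      by_cases hx : ∃ j, x ∈ C j
      · obtain ⟨j, hj⟩ := hx
        have hnot : ∀ i, i ≠ j → x ∉ C i := fun i hij hi =>
          (Set.disjoint_left.mp (hd hij) hi) hj
        rw [Finset.sum_eq_single j (fun i _ hij => by simp [hnot i hij, expNeg_zero]) (by simp),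
          Finset.sum_eq_single j (fun i _ hij => by simp [hnot i hij]) (by simp)]
      · push Not at hx
        simp [hx, expNeg_zero]
    simp_rw [hpt]
    rw [← h _ (Finset.measurable_sum _ fun i _ => hm i)]
    refine lintegral_congr fun s => ?_
    rw [lintegral_finsetSum _ fun i _ => hm i]
    simp_rw [lintegral_const_mul _ (measurable_one.indicator (hC _)),
      lintegral_indicator_one (hC _)]

end

/-! ### The marking theorem -/

section


/-- Finite product measures depend measurably on their factors. -/
lemma measurable_measure_pi {α : Type*} [MeasurableSpace α] {n : ℕ} {Y : Fin n → Type*}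
    [∀ i, MeasurableSpace (Y i)] (m : ∀ i, α → Measure (Y i))
    [∀ i a, IsFiniteMeasure (m i a)] (hm : ∀ i, Measurable (m i)) :
    Measurable fun a => Measure.pi fun i => m i a := by
  refine Measurable.measure_of_isPiSystem generateFrom_pi.symm isPiSystem_pi ?_ ?_
  · rintro _ ⟨C, hC, rfl⟩
    simp_rw [Measure.pi_pi]
    exact Finset.measurable_prod _ fun i _ =>
      (Measure.measurable_coe (hC i (mem_univ i))).comp (hm i)
  · simp_rw [Measure.pi_univ]
    exact Finset.measurable_prod _ fun i _ => (Measure.measurable_coe .univ).comp (hm i)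

/-- Integration of a product over blocks of independent coordinates `y (i, k)`, `i < M`. -/
lemma lintegral_infinitePi_blocks {M : ℕ} (m : ℕ → Measure ℝ) [∀ k, IsProbabilityMeasure (m k)]
    (U : ℕ → (Fin M → ℝ) → ℝ≥0∞) (hU : ∀ k, Measurable (U k)) (n : ℕ) :
    ∫⁻ y, ∏ k ∈ Finset.range n, U k (fun i => y (i, k))
      ∂(Measure.infinitePi fun j : Fin M × ℕ => m j.2) =
    ∏ k ∈ Finset.range n, ∫⁻ a, U k a ∂(Measure.pi fun _ : Fin M => m k) := by
  -- Swapping the indices and currying turns the family into a sequence of independent blocks, one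
  -- for each point $k$.
  let e : ℕ × Fin M ≃ Fin M × ℕ := Equiv.prodComm _ _
  have h1 := Measure.infinitePi_map_piCongrLeft (X := fun _ => ℝ)
    (fun j : Fin M × ℕ => m j.2) e
  have h2 := Measure.infinitePi_map_curry_symm (X := ℝ) (fun (k : ℕ) (_ : Fin M) => m k)
  have h3 : (fun j : ℕ × Fin M => m (e j).2) = fun j => m j.1 := rfl
  rw [h3, ← h2] at h1
  rw [← h1, lintegral_map_equiv, lintegral_map_equiv]
  have h4 : ∀ (y : ℕ → Fin M → ℝ) i k, MeasurableEquiv.piCongrLeft (fun _ => ℝ) e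
      ((MeasurableEquiv.curry ℕ (Fin M) ℝ).symm y) (i, k) = y k i := by
    intro y i k
    exact Equiv.piCongrLeft_apply_apply (fun _ => ℝ) e _ (k, i)
  simp_rw [h4]
  have h5 : (Measure.infinitePi fun k : ℕ => Measure.infinitePi fun _ : Fin M => m k) =
      Measure.infinitePi fun k : ℕ => Measure.pi fun _ : Fin M => m k := by
    congr 1
    ext1 k
    exact Measure.infinitePi_eq_pi _
  rw [h5, lintegral_prod_eq_prod_lintegral_of_indepFun (Finset.range n)
    (fun k (y : ℕ → Fin M → ℝ) => U k (y k))
    (iIndepFun_infinitePi (P := fun k : ℕ => Measure.pi fun _ : Fin M => m k)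
      (X := U) hU) fun k => (hU k).comp (measurable_pi_apply k)]
  refine Finset.prod_congr rfl fun k _ => ?_
  rw [← (measurePreserving_eval_infinitePi (fun k : ℕ => Measure.pi fun _ : Fin M => m k)
    k).map_eq, lintegral_map (hU k) (measurable_pi_apply k)]

variable {S Ω : Type*} [MeasurableSpace Ω]

/-- The law of the marks `(A₁, …, A_M)` of a point `(s, ω)`. -/
def markKernel (G : Kernel ℝ ℝ) [IsMarkovKernel G] (M : ℕ) : Kernel (ℝ × Ω) (Fin M → ℝ) where
  toFun p := Measure.pi fun _ : Fin M => G p.1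
  measurable' := measurable_measure_pi (fun _ (p : ℝ × Ω) => G p.1) fun _ =>
    G.measurable.comp measurable_fst

lemma markKernel_apply (G : Kernel ℝ ℝ) [IsMarkovKernel G] (M : ℕ) (p : ℝ × Ω) :
    markKernel G M p = Measure.pi fun _ : Fin M => G p.1 := rfl

instance (G : Kernel ℝ ℝ) [IsMarkovKernel G] (M : ℕ) :
    IsMarkovKernel (markKernel (Ω := Ω) G M) :=
  ⟨fun p => by rw [markKernel_apply]; infer_instance⟩

/-- The marked point process `∑ δ_((τ k, w k), (A 1 k, …, A M k))`. -/
def markedPoints {M : ℕ} (τ : ℕ → S → ℝ) (w : ℕ → S → Ω) (A : Fin M → ℕ → S → ℝ) (s : S) :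
    Measure ((ℝ × Ω) × (Fin M → ℝ)) :=
  Measure.sum fun k : {k : ℕ // 0 < τ k s} => Measure.dirac ((τ k s, w k s), fun i => A i k s)

/-- The index type of the sum depends on $s$; rewriting it as a series over all $k$ with an
indicator makes measurability in $s$ and limits of partial products accessible. -/
lemma lintegral_markedPoints {M : ℕ} (τ : ℕ → S → ℝ) (w : ℕ → S → Ω) (A : Fin M → ℕ → S → ℝ)
    (s : S) {f : (ℝ × Ω) × (Fin M → ℝ) → ℝ≥0∞} (hf : Measurable f) :
    ∫⁻ x, f x ∂(markedPoints τ w A s) =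
      ∑' k, {k | 0 < τ k s}.indicator (fun k => f ((τ k s, w k s), fun i => A i k s)) k := by
  rw [markedPoints, lintegral_sum_measure, ← tsum_subtype]
  exact tsum_congr fun k => lintegral_dirac' _ hf

lemma map_fst_markedPoints {M : ℕ} (τ : ℕ → S → ℝ) (w : ℕ → S → Ω) (A : Fin M → ℕ → S → ℝ)
    (s : S) : (markedPoints τ w A s).map Prod.fst =
      Measure.sum fun k : {k : ℕ // 0 < τ k s} => Measure.dirac (τ k s, w k s) := by
  rw [markedPoints, Measure.map_sum measurable_fst.aemeasurable]
  congr 1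
  ext1 k
  rw [Measure.map_dirac' measurable_fst]

/-- Since $\min(s,1)>0$ on $(0,\infty)$, integrability forces $\rho<\infty$ almost everywhere, and a
finite density preserves σ-finiteness. -/
lemma sigmaFinite_levyMeasure {ρ : ℝ → Ω → ℝ≥0∞} {B0 : Measure Ω} [IsProbabilityMeasure B0]
    (hρ_meas : Measurable (Function.uncurry ρ))
    (hρ : ∀ᵐ ω ∂B0, ∫⁻ s in Ioi (0 : ℝ), ENNReal.ofReal (min s 1) * ρ s ω ≠ ∞) :
    SigmaFinite (levyMeasure ρ B0) := by
  refine SigmaFinite.withDensity_of_ne_top ?_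
  have hm : MeasurableSet {p : ℝ × Ω | ρ p.1 p.2 ≠ ∞} :=
    (hρ_meas (measurableSet_singleton ∞)).compl
  rw [Measure.ae_prod_iff_ae_ae hm, Measure.ae_ae_comm hm]
  filter_upwards [hρ] with ω hω
  have hmeas : Measurable fun s : ℝ => ENNReal.ofReal (min s 1) * ρ s ω := by
    have : Measurable fun s => ρ s ω := hρ_meas.comp (measurable_id.prodMk measurable_const)
    fun_prop
  filter_upwards [ae_lt_top hmeas hω, ae_restrict_mem measurableSet_Ioi] with s hs hs0 hc
  rw [hc, ENNReal.mul_top] at hs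
  · exact lt_irrefl _ hs
  · have : (0 : ℝ) < s := hs0
    simp [this]

section Model

variable [MeasurableSpace S] {P : Measure S} {G : Kernel ℝ ℝ} [IsMarkovKernel G]
  {ν : Measure (ℝ × Ω)} {M : ℕ} {τ : ℕ → S → ℝ} {w : ℕ → S → Ω} {A : Fin M → ℕ → S → ℝ}
  {N : S → Measure (ℝ × Ω)} {μ : S → Measure Ω} {Z : Fin M → S → SignedMeasure Ω}

lemma IsIBPModel.measurable_markedPoints (h : IsIBPModel P G ν M τ w A N μ Z) :
    Measurable (markedPoints τ w A) := by
  refine Measure.measurable_of_measurable_coe _ fun C hC => ?_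
  have : ∀ s, markedPoints τ w A s C = ∑' k, {s | 0 < τ k s}.indicator
      (fun s => C.indicator 1 ((τ k s, w k s), fun i => A i k s)) s := fun s => by
    rw [← lintegral_indicator_one hC, lintegral_markedPoints _ _ _ _ (measurable_one.indicator hC)]
    rfl
  simp_rw [this]
  refine Measurable.tsum fun k => Measurable.indicator ?_
    (measurableSet_lt measurable_const (h.measurable_τ k))
  exact (measurable_one.indicator hC).comp (((h.measurable_τ k).prodMk (h.measurable_w k)).prodMk
    (measurable_pi_lambda _ fun i => h.measurable_A i k))

variable [IsProbabilityMeasure P]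

/-- The marks may be integrated out, given the points. -/
lemma IsIBPModel.lintegral_prod_marks (h : IsIBPModel P G ν M τ w A N μ Z)
    {U : (ℝ × Ω) × (Fin M → ℝ) → ℝ≥0∞} (hU : Measurable U) (n : ℕ) :
    ∫⁻ s, ∏ k ∈ Finset.range n, U ((τ k s, w k s), fun i => A i k s) ∂P =
      ∫⁻ s, ∏ k ∈ Finset.range n, (∫⁻ a, U ((τ k s, w k s), a)
        ∂(markKernel G M (τ k s, w k s))) ∂P := by
  obtain ⟨κ, hκ, hcd⟩ := h.marks
  have : IsMarkovKernel κ := ⟨fun x => by rw [hκ]; infer_instance⟩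
  have hX : Measurable fun s k => (τ k s, w k s) :=
    measurable_pi_lambda _ fun k => (h.measurable_τ k).prodMk (h.measurable_w k)
  have hY : Measurable fun s (j : Fin M × ℕ) => A j.1 j.2 s :=
    measurable_pi_lambda _ fun j => h.measurable_A j.1 j.2
  let H : (ℕ → ℝ × Ω) × (Fin M × ℕ → ℝ) → ℝ≥0∞ := fun q =>
    ∏ k ∈ Finset.range n, U (q.1 k, fun i => q.2 (i, k))
  have hH : Measurable H := by
    refine Finset.measurable_prod _ fun k _ => hU.comp ?_
    fun_prop
  have hcd' : P.map (fun s => ((fun k => (τ k s, w k s)), fun j : Fin M × ℕ => A j.1 j.2 s)) =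
    P.map (fun s k => (τ k s, w k s)) ⊗ₘ κ := hcd.map_eq
  calc ∫⁻ s, H ((fun k => (τ k s, w k s)), fun j => A j.1 j.2 s) ∂P
      = ∫⁻ q, H q ∂(P.map (fun s k => (τ k s, w k s)) ⊗ₘ κ) := by
        rw [← hcd', lintegral_map hH (hX.prodMk hY)]
    _ = ∫⁻ s, ∫⁻ y, H ((fun k => (τ k s, w k s)), y) ∂(κ fun k => (τ k s, w k s)) ∂P := by
        rw [Measure.lintegral_compProd hH, lintegral_map (hH.lintegral_kernel_prod_right') hX]
    _ = _ := by
        refine lintegral_congr fun s => ?_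
        rw [hκ]
        exact lintegral_infinitePi_blocks (fun k => G (τ k s))
          (fun k a => U ((τ k s, w k s), a))
          (fun k => hU.comp (measurable_const.prodMk measurable_id)) n

/-- The marking theorem: the marked process is Poisson. -/
lemma IsIBPModel.hasPoissonLaplace_markedPoints [SigmaFinite ν]
    (h : IsIBPModel P G ν M τ w A N μ Z) :
    HasPoissonLaplace P (markedPoints τ w A) (ν ⊗ₘ markKernel G M) := by
  classical
  intro f hf
  -- Indices with $\tau_k=0$ are not points and must contribute the factor $1$ to the product.
  let U : (ℝ × Ω) × (Fin M → ℝ) → ℝ≥0∞ :=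
    {q | 0 < q.1.1}.piecewise (fun q => expNeg (f q)) fun _ => 1
  have hpos : MeasurableSet {q : (ℝ × Ω) × (Fin M → ℝ) | 0 < q.1.1} :=
    measurableSet_lt measurable_const (by fun_prop)
  have hU : Measurable U := Measurable.piecewise hpos (by fun_prop) measurable_const
  let v : ℝ × Ω → ℝ≥0∞ := fun p => ∫⁻ a, expNeg (f (p, a)) ∂(markKernel G M p)
  have hv : Measurable v := (measurable_expNeg.comp hf).lintegral_kernel_prod_right'
  have hv1 : ∀ p, v p ≤ 1 := fun p =>
    (lintegral_mono fun a => expNeg_le_one (f (p, a))).trans (by simp)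
  -- Averaging $e^{-f}$ over the marks leaves the factor $v=e^{-F}$ at each point, so the functional
  -- of the marked process at $f$ equals that of $N$ at $F$.
  let F : ℝ × Ω → ℝ≥0∞ := fun p => negLog (v p)
  have hF : Measurable F := by fun_prop
  have hL : ∀ s, Filter.Tendsto (fun n => ∏ k ∈ Finset.range n,
      U ((τ k s, w k s), fun i => A i k s)) Filter.atTop
      (nhds (expNeg (∫⁻ x, f x ∂(markedPoints τ w A s)))) := by
    intro s
    rw [lintegral_markedPoints _ _ _ _ hf]
    refine (tendsto_prod_expNeg _).congr fun n => Finset.prod_congr rfl fun k _ => ?_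
    by_cases hk : 0 < τ k s <;> simp [U, hk, expNeg_zero]
  have hR : ∀ᵐ s ∂P, Filter.Tendsto (fun n => ∏ k ∈ Finset.range n,
      (∫⁻ a, U ((τ k s, w k s), a) ∂(markKernel G M (τ k s, w k s)))) Filter.atTop
      (nhds (expNeg (∫⁻ x, F x ∂(N s)))) := by
    filter_upwards [h.N_eq] with s hs
    rw [hs, lintegral_sum_measure]
    simp_rw [lintegral_dirac' _ hF]
    have hsub : ∑' k : {k : ℕ // 0 < τ k s}, F (τ k s, w k s) =
        ∑' k, {k | 0 < τ k s}.indicator (fun k => F (τ k s, w k s)) k :=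
      tsum_subtype {k | 0 < τ k s} fun k => F (τ k s, w k s)
    rw [hsub]
    refine (tendsto_prod_expNeg _).congr fun n => Finset.prod_congr rfl fun k _ => ?_
    by_cases hk : 0 < τ k s
    · simp [U, hk, F, expNeg_negLog (hv1 _), v]
    · simp [U, hk, expNeg_zero]
  have hU1 : ∀ q, U q ≤ 1 := fun q => by
    by_cases hq : 0 < q.1.1 <;> simp [U, hq, expNeg_le_one]
  have hpt : ∀ k, Measurable fun s => (τ k s, w k s) := fun k =>
    (h.measurable_τ k).prodMk (h.measurable_w k)
  have hlimL := tendsto_lintegral_of_dominated_convergence (μ := P) (fun _ => 1)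
    (fun n => Finset.measurable_prod (Finset.range n) fun k _ => hU.comp ((hpt k).prodMk
      (measurable_pi_lambda _ fun i => h.measurable_A i k)))
    (fun n => .of_forall fun s => Finset.prod_le_one' fun k _ => hU1 _) (by simp)
    (.of_forall hL)
  have hlimR := tendsto_lintegral_of_dominated_convergence (μ := P) (fun _ => 1)
    (fun n => Finset.measurable_prod (Finset.range n) fun k _ =>
      (hU.lintegral_kernel_prod_right' (κ := markKernel G M)).comp (hpt k))
    (fun n => .of_forall fun s => Finset.prod_le_one' fun k _ =>
      (lintegral_mono fun a => hU1 _).trans (by simp)) (by simp) hR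
  have heq := tendsto_nhds_unique hlimL (hlimR.congr fun n => (h.lintegral_prod_marks hU n).symm)
  rw [heq, h.isPRM.hasPoissonLaplace F hF, Measure.lintegral_compProd (by fun_prop)]
  congr 1
  refine lintegral_congr fun p => ?_
  have hm : Measurable fun a => expNeg (f (p, a)) := by fun_prop
  rw [expNeg_negLog (hv1 p), lintegral_sub hm
    ((lintegral_mono fun a => expNeg_le_one (f (p, a))).trans_lt (by simp)).ne
    (.of_forall fun a => expNeg_le_one _)]
  simp [v]

end Model

end

/-! ### Splitting the marked process into unmarked and marked points -/

section


variable {Ω : Type*} [MeasurableSpace Ω] {G : Kernel ℝ ℝ}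

@[fun_prop]
lemma measurable_mass_zero : Measurable fun s => G s {0} :=
  G.measurable_coe (measurableSet_singleton 0)

variable [IsMarkovKernel G]

lemma one_sub_piA (s : ℝ) : 1 - piA G s = G s {0} := by
  rw [piA, prob_compl_eq_one_sub (measurableSet_singleton 0),
    ENNReal.sub_sub_cancel (by simp) prob_le_one]

/-- The atom at $0$ regains its mass $1-\pi_A(s)$, and off $0$ the normalization cancels. -/
lemma smul_hMeasure {s : ℝ} (hs : 0 < G s {0}) : G s {0} • hMeasure G s = G s := by
  rw [hMeasure, one_sub_piA, smul_add, smul_smul,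
    ENNReal.mul_inv_cancel hs.ne' (measure_ne_top _ _), one_smul, ← Measure.restrict_singleton,
    Measure.restrict_add_restrict_compl (measurableSet_singleton 0)]

lemma isFiniteMeasure_hMeasure {s : ℝ} (hs : 0 < G s {0}) : IsFiniteMeasure (hMeasure G s) := by
  refine ⟨?_⟩
  rw [hMeasure, one_sub_piA, Measure.add_apply, Measure.smul_apply, smul_eq_mul]
  exact ENNReal.add_lt_top.mpr ⟨measure_lt_top _ _,
    ENNReal.mul_lt_top (ENNReal.inv_lt_top.mpr hs) (measure_lt_top _ _)⟩

lemma pi_hMeasure {s : ℝ} (hs : 0 < G s {0}) (M : ℕ) :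
    (Measure.pi fun _ : Fin M => hMeasure G s) =
      ((G s {0}) ^ M)⁻¹ • Measure.pi fun _ : Fin M => G s := by
  have := isFiniteMeasure_hMeasure hs
  refine Measure.pi_eq fun C hC => ?_
  rw [Measure.smul_apply, Measure.pi_pi, smul_eq_mul]
  have : ∀ i, G s (C i) = G s {0} * hMeasure G s (C i) := fun i => by
    conv_lhs => rw [← smul_hMeasure hs]
    rfl
  simp_rw [this]
  rw [Finset.prod_mul_distrib, Finset.prod_const, Finset.card_univ, Fintype.card_fin, ← mul_assoc,
    ENNReal.inv_mul_cancel (pow_ne_zero _ hs.ne') (ENNReal.pow_ne_top (measure_ne_top _ _)),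
    one_mul]

variable {ρ : ℝ → Ω → ℝ≥0∞} {B0 : Measure Ω} {M : ℕ}

lemma levyMeasure_rhoM [SFinite B0] (hρ : Measurable (Function.uncurry ρ)) :
    levyMeasure (rhoM G ρ M) B0 = (levyMeasure ρ B0).withDensity fun p => (G p.1 {0}) ^ M := by
  rw [levyMeasure, levyMeasure, ← withDensity_mul _ (by exact hρ) (by fun_prop)]
  congr 1
  ext p
  simp [rhoM, one_sub_piA, mul_comm]

/-- `((s, ω), a)` from `((a, ω), s)`. -/
def toMarked (x : ((Fin M → ℝ) × Ω) × ℝ) : (ℝ × Ω) × (Fin M → ℝ) := ((x.2, x.1.2), x.1.1)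

@[fun_prop]
lemma measurable_toMarked : Measurable (toMarked (Ω := Ω) (M := M)) := by
  unfold toMarked
  fun_prop

lemma measurableSet_marked_ne_zero :
    MeasurableSet {q : (ℝ × Ω) × (Fin M → ℝ) | q.2 ≠ 0} :=
  (measurable_snd (measurableSet_singleton 0)).compl

/-- The factor $[1-\pi_A]^M$ in $\rho_M$ cancels the $[1-\pi_A]^{-M}$ of `pi_hMeasure`. What remains
is the mean measure of the marked process on $a\ne0$, with the coordinates reordered. -/
lemma featureJump_eq [SFinite B0] [SFinite (levyMeasure ρ B0)]
    (hρ : Measurable (Function.uncurry ρ))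
    (hG : ∀ᵐ p ∂(levyMeasure ρ B0), 0 < G p.1 {0}) :
    featureJump G ρ B0 M = ((levyMeasure ρ B0 ⊗ₘ markKernel G M).restrict {q | q.2 ≠ 0}).map
      fun q => ((q.2, q.1.2), q.1.1) := by
  have hac : levyMeasure (rhoM G ρ M) B0 ≪ levyMeasure ρ B0 := by
    rw [levyMeasure_rhoM hρ]
    exact withDensity_absolutelyContinuous _ _
  -- The integrand is replaced by a version that is measurable for all $p$; the two agree wherever
  -- $G_A(\{0\}\mid s)>0$, hence almost everywhere.
  have hm : Measurable fun p : ℝ × Ω => (((G p.1 {0}) ^ M)⁻¹ •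
      (markKernel G M p).map fun a => ((a, p.2), p.1)) := by
    refine Measure.measurable_of_measurable_coe _ fun C hC => ?_
    simp_rw [Measure.smul_apply, smul_eq_mul]
    refine Measurable.mul (by fun_prop) ?_
    have : ∀ p : ℝ × Ω, (markKernel G M p).map (fun a => ((a, p.2), p.1)) C =
        markKernel G M p (Prod.mk p ⁻¹'
          ((fun q : (ℝ × Ω) × (Fin M → ℝ) => ((q.2, q.1.2), q.1.1)) ⁻¹' C)) := fun p => by
      rw [Measure.map_apply (by fun_prop) hC]
      rfl
    simp_rw [this]
    exact Kernel.measurable_kernel_prodMk_left (hC.preimage (by fun_prop))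
  have hbind : (levyMeasure (rhoM G ρ M) B0).bind (fun p =>
      (Measure.pi fun _ : Fin M => hMeasure G p.1).map fun a => ((a, p.2), p.1)) =
      (levyMeasure (rhoM G ρ M) B0).bind fun p => (((G p.1 {0}) ^ M)⁻¹ •
      (markKernel G M p).map fun a => ((a, p.2), p.1)) := by
    refine Measure.bind_congr_right ?_
    filter_upwards [hac.ae_le hG] with p hp
    rw [pi_hMeasure hp, Measure.map_smul, markKernel_apply]
  have hne : MeasurableSet {x : ((Fin M → ℝ) × Ω) × ℝ | x.1.1 ≠ 0} :=
    ((measurable_fst.comp measurable_fst) (measurableSet_singleton 0)).compl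
  ext C hC
  have hCne := hC.inter hne
  rw [featureJump, hbind, Measure.restrict_apply hC, Measure.bind_apply hCne hm.aemeasurable,
    levyMeasure_rhoM hρ, lintegral_withDensity_eq_lintegral_mul _ (by fun_prop)
      (g := fun p => (((G p.1 {0}) ^ M)⁻¹ •
        (markKernel G M p).map fun a => ((a, p.2), p.1)) (C ∩ {x | x.1.1 ≠ 0}))
      ((Measure.measurable_coe hCne).comp hm), Measure.map_apply (by fun_prop) hC,
    Measure.restrict_apply (hC.preimage (by fun_prop)),
    Measure.compProd_apply ((hC.preimage (by fun_prop)).inter measurableSet_marked_ne_zero)]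
  refine lintegral_congr_ae ?_
  filter_upwards [hG] with p hp
  rw [Pi.mul_apply, Measure.smul_apply, smul_eq_mul, ← mul_assoc,
    ENNReal.mul_inv_cancel (pow_ne_zero _ hp.ne') (ENNReal.pow_ne_top (measure_ne_top _ _)),
    one_mul, Measure.map_apply (by fun_prop) hCne]
  rfl

lemma markKernel_singleton_zero (p : ℝ × Ω) : markKernel G M p {0} = (G p.1 {0}) ^ M := by
  rw [markKernel_apply, Measure.pi_singleton]
  simp

lemma lintegral_featureJump [SFinite B0] [SFinite (levyMeasure ρ B0)]
    (hρ : Measurable (Function.uncurry ρ))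
    (hG : ∀ᵐ p ∂(levyMeasure ρ B0), 0 < G p.1 {0})
    {f : (ℝ × Ω) × (Fin M → ℝ) → ℝ≥0∞} (hf : Measurable f) :
    ∫⁻ x, f (toMarked x) ∂(featureJump G ρ B0 M) =
      ∫⁻ q in {q | q.2 ≠ 0}, f q ∂(levyMeasure ρ B0 ⊗ₘ markKernel G M) := by
  rw [featureJump_eq hρ hG, lintegral_map (by fun_prop) (by fun_prop)]
  rfl

lemma lintegral_mark_zero [SFinite B0] [SFinite (levyMeasure ρ B0)]
    (hρ : Measurable (Function.uncurry ρ))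
    {f : (ℝ × Ω) × (Fin M → ℝ) → ℝ≥0∞} (hf : Measurable f) :
    ∫⁻ q in {q | q.2 ≠ 0}ᶜ, f q ∂(levyMeasure ρ B0 ⊗ₘ markKernel G M) =
      ∫⁻ p, f (p, 0) ∂(levyMeasure (rhoM G ρ M) B0) := by
  rw [← lintegral_indicator measurableSet_marked_ne_zero.compl,
    Measure.lintegral_compProd (hf.indicator measurableSet_marked_ne_zero.compl),
    levyMeasure_rhoM hρ, lintegral_withDensity_eq_lintegral_mul _ (by fun_prop)
      (by fun_prop)]
  refine lintegral_congr fun p => ?_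
  rw [Pi.mul_apply, ← markKernel_singleton_zero, mul_comm,
    ← lintegral_indicator_const (measurableSet_singleton 0)]
  refine lintegral_congr fun a => ?_
  by_cases ha : a = 0 <;> simp [ha]

/-- The marks of a point at $s$ are not all zero with probability $1-[1-\pi_A(s)]^M$, which is the
integrand of $\Psi$. -/
lemma featureJump_univ [SFinite B0] [SFinite (levyMeasure ρ B0)]
    (hρ : Measurable (Function.uncurry ρ))
    (hG : ∀ᵐ p ∂(levyMeasure ρ B0), 0 < G p.1 {0}) :
    featureJump G ρ B0 M univ = Psi G ρ B0 M := by
  rw [← lintegral_one, lintegral_featureJump hρ hG (f := fun _ => 1) measurable_const,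
    setLIntegral_one, Measure.compProd_apply measurableSet_marked_ne_zero, Psi]
  refine lintegral_congr fun p => ?_
  have : Prod.mk p ⁻¹' {q : (ℝ × Ω) × (Fin M → ℝ) | q.2 ≠ 0} = {0}ᶜ := rfl
  rw [this, prob_compl_eq_one_sub (measurableSet_singleton 0), markKernel_singleton_zero,
    one_sub_piA]

section Law

variable {S : Type*} [MeasurableSpace S] {P : Measure S}

/-- The process of the points with all marks equal to zero. -/
def unmarkedPart (n : Measure ((ℝ × Ω) × (Fin M → ℝ))) : Measure (ℝ × Ω) :=
  (n.restrict {q | q.2 ≠ 0}ᶜ).map Prod.fst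

@[fun_prop]
lemma measurable_unmarkedPart : Measurable (unmarkedPart (Ω := Ω) (M := M)) := by
  refine (Measure.measurable_map _ measurable_fst).comp
    (Measure.measurable_of_measurable_coe _ fun C hC => ?_)
  simp_rw [Measure.restrict_apply hC]
  exact Measure.measurable_coe (hC.inter measurableSet_marked_ne_zero.compl)

/-- The points with nonzero marks are removed: the remaining ones are Poisson. -/
lemma HasPoissonLaplace.unmarked [SFinite B0] [SFinite (levyMeasure ρ B0)]
    (hρ : Measurable (Function.uncurry ρ)) {Y : S → Measure ((ℝ × Ω) × (Fin M → ℝ))}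
    (hY : HasPoissonLaplace P Y (levyMeasure ρ B0 ⊗ₘ markKernel G M)) :
    HasPoissonLaplace P (fun s => unmarkedPart (Y s)) (levyMeasure (rhoM G ρ M) B0) := by
  intro f hf
  have hf' : Measurable fun q : (ℝ × Ω) × (Fin M → ℝ) => f q.1 := by fun_prop
  have h := hY _ (hf'.indicator measurableSet_marked_ne_zero.compl)
  have hR : ∀ q : (ℝ × Ω) × (Fin M → ℝ), 1 - expNeg (({q | q.2 ≠ 0}ᶜ : Set _).indicator
      (fun q : (ℝ × Ω) × (Fin M → ℝ) => f q.1) q) =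
      ({q | q.2 ≠ 0}ᶜ : Set _).indicator (fun q => 1 - expNeg (f q.1)) q := fun q => by
    by_cases hq : q.2 = 0 <;> simp [hq, expNeg_zero]
  simp_rw [hR] at h
  simp_rw [lintegral_indicator measurableSet_marked_ne_zero.compl] at h
  rw [lintegral_mark_zero (f := fun q => 1 - expNeg (f q.1)) hρ (by fun_prop)] at h
  rw [← h]
  refine lintegral_congr fun s => ?_
  exact congrArg expNeg (lintegral_map hf measurable_fst)

/-- The configuration with unmarked points `n` and marked points `y l`. -/
def combine {K : ℕ} (q : Measure (ℝ × Ω) × (Fin K → ((Fin M → ℝ) × Ω) × ℝ)) :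
    Measure ((ℝ × Ω) × (Fin M → ℝ)) :=
  q.1.map (fun p => (p, 0)) + ∑ l, Measure.dirac (toMarked (q.2 l))

@[fun_prop]
lemma measurable_combine {K : ℕ} : Measurable (combine (Ω := Ω) (M := M) (K := K)) := by
  refine Measurable.add ((Measure.measurable_map _ (by fun_prop)).comp measurable_fst) ?_
  exact Finset.measurable_sum _ fun l _ => Measure.measurable_dirac.comp (by fun_prop)

lemma lintegral_combine {K : ℕ} (q : Measure (ℝ × Ω) × (Fin K → ((Fin M → ℝ) × Ω) × ℝ))
    {f : (ℝ × Ω) × (Fin M → ℝ) → ℝ≥0∞} (hf : Measurable f) :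
    ∫⁻ x, f x ∂(combine q) = ∫⁻ p, f (p, 0) ∂q.1 + ∑ l, f (toMarked (q.2 l)) := by
  rw [combine, lintegral_add_measure, lintegral_map hf (by fun_prop), lintegral_finsetSum_measure]
  simp_rw [lintegral_dirac' _ hf]

/-- The law of the marked process, with the unmarked points of law `R`. -/
def markedLaw (R : Measure (Measure (ℝ × Ω))) (G : Kernel ℝ ℝ) (ρ : ℝ → Ω → ℝ≥0∞)
    (B0 : Measure Ω) (M : ℕ) : Measure (Measure ((ℝ × Ω) × (Fin M → ℝ))) :=
  ENNReal.ofReal (Real.exp (-(Psi G ρ B0 M).toReal)) •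
    Measure.sum fun K : ℕ => ((K.factorial : ℝ≥0∞)⁻¹) •
      (R.prod (Measure.pi fun _ : Fin K => featureJump G ρ B0 M)).map combine

-- Both sides have the same Laplace functional. With $a$ the functional of the unmarked part and
-- $b=\int e^{-f}d\Lambda$, the mixture gives $a\,e^{-\Psi}\sum_K b^K/K!=a\,e^{-(\Psi-b)}$. Here
-- $\Psi-b=\int(1-e^{-f})\,d\Lambda$ is the exponent from $a\ne0$, and it adds to the exponent of
-- $a$ to give the full one.
variable [IsProbabilityMeasure P] in
lemma map_markedPoints_eq [SFinite B0] [SFinite (levyMeasure ρ B0)]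
    (hρ : Measurable (Function.uncurry ρ))
    (hG : ∀ᵐ p ∂(levyMeasure ρ B0), 0 < G p.1 {0}) (hΨ : Psi G ρ B0 M ≠ ∞)
    {Y : S → Measure ((ℝ × Ω) × (Fin M → ℝ))} (hYm : Measurable Y)
    (hY : HasPoissonLaplace P Y (levyMeasure ρ B0 ⊗ₘ markKernel G M)) :
    P.map Y = markedLaw (P.map fun s => unmarkedPart (Y s)) G ρ B0 M := by
  have hum : Measurable fun s => unmarkedPart (Y s) := measurable_unmarkedPart.comp hYm
  have hΛ : IsFiniteMeasure (featureJump G ρ B0 M) :=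
    ⟨by rw [featureJump_univ hρ hG]; exact hΨ.lt_top⟩
  have := Measure.isProbabilityMeasure_map (μ := P) hum.aemeasurable
  have := Measure.isProbabilityMeasure_map (μ := P) hYm.aemeasurable
  set R := P.map fun s => unmarkedPart (Y s) with hR
  have key : ∀ f : (ℝ × Ω) × (Fin M → ℝ) → ℝ≥0∞, Measurable f →
      ∫⁻ n, expNeg (∫⁻ x, f x ∂n) ∂(markedLaw R G ρ B0 M) =
        ∫⁻ n, expNeg (∫⁻ x, f x ∂n) ∂(P.map Y) := by
    intro f hf
    have hef : Measurable fun n : Measure ((ℝ × Ω) × (Fin M → ℝ)) => expNeg (∫⁻ x, f x ∂n) :=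
      measurable_expNeg.comp (Measure.measurable_lintegral hf)
    have hef0 : Measurable fun n : Measure (ℝ × Ω) => expNeg (∫⁻ p, f (p, 0) ∂n) :=
      measurable_expNeg.comp (Measure.measurable_lintegral (by fun_prop))
    set b := ∫⁻ y, expNeg (f (toMarked y)) ∂(featureJump G ρ B0 M) with hb
    set a := ∫⁻ n, expNeg (∫⁻ p, f (p, 0) ∂n) ∂(R) with ha
    have hbΨ : b ≤ Psi G ρ B0 M := by
      rw [← featureJump_univ hρ hG, ← lintegral_one]
      exact lintegral_mono fun _ => expNeg_le_one _
    have hK : ∀ K : ℕ, ∫⁻ n, expNeg (∫⁻ x, f x ∂n)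
        ∂((R.prod (Measure.pi fun _ : Fin K => featureJump G ρ B0 M)).map combine) =
        a * b ^ K := by
      intro K
      rw [lintegral_map hef (by fun_prop)]
      simp_rw [lintegral_combine _ hf, expNeg_add, expNeg_sum]
      rw [lintegral_prod_mul (f := fun n : Measure (ℝ × Ω) => expNeg (∫⁻ p, f (p, 0) ∂n))
          (g := fun y : Fin K → ((Fin M → ℝ) × Ω) × ℝ => ∏ l, expNeg (f (toMarked (y l))))
          hef0.aemeasurable (Measurable.aemeasurable (by fun_prop)),
        lintegral_pi_prod (fun _ : Fin K => featureJump G ρ B0 M)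
          (f := fun _ y => expNeg (f (toMarked y))) fun _ => by fun_prop]
      simp [← hb, ← ha]
    rw [markedLaw, lintegral_smul_measure, lintegral_sum_measure]
    simp_rw [lintegral_smul_measure, hK, smul_eq_mul]
    have h1 : ∀ K : ℕ, (K.factorial : ℝ≥0∞)⁻¹ * (a * b ^ K) =
        a * ((K.factorial : ℝ≥0∞)⁻¹ * b ^ K) := fun K => by ring
    simp_rw [h1]
    rw [ENNReal.tsum_mul_left, tsum_inv_factorial_mul_pow (hbΨ.trans_lt hΨ.lt_top).ne,
      mul_left_comm, ← expNeg_ofReal ENNReal.toReal_nonneg, ENNReal.ofReal_toReal hΨ,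
      expNeg_mul_exp hΨ hbΨ]
    have h2 : Psi G ρ B0 M - b =
        ∫⁻ y, (1 - expNeg (f (toMarked y))) ∂(featureJump G ρ B0 M) := by
      rw [lintegral_sub (by fun_prop) (hbΨ.trans_lt hΨ.lt_top).ne
        (.of_forall fun _ => expNeg_le_one _), lintegral_one, featureJump_univ hρ hG]
    rw [h2, ha, hR, lintegral_map hef0 hum, hY.unmarked hρ _ (by fun_prop), ← expNeg_add,
      lintegral_map hef hYm, hY f hf,
      lintegral_featureJump (f := fun q => 1 - expNeg (f q)) hρ hG (by fun_prop),
      ← lintegral_mark_zero (f := fun q => 1 - expNeg (f q)) hρ (by fun_prop), add_comm,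
      lintegral_add_compl _ measurableSet_marked_ne_zero]
  -- The test function $f=0$ in the identity just proved yields the total mass.
  have hfin : IsFiniteMeasure (markedLaw R G ρ B0 M) := by
    refine ⟨?_⟩
    have := key 0 measurable_const
    simp only [Pi.zero_apply, lintegral_zero, expNeg_zero, lintegral_one] at this
    rw [this]
    exact measure_lt_top _ _
  exact measure_eq_of_laplaceFunctional fun f hf => (key f hf).symm

end Law

end

/-! ### Observations and points as functions of the marked process -/

section


variable {Ω : Type*} [MeasurableSpace Ω]

lemma measurable_signedMeasure_iff {α : Type*} [MeasurableSpace α] {f : α → SignedMeasure Ω} :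
    Measurable f ↔ ∀ B, MeasurableSet B → Measurable fun a => f a B := by
  have hb : (borel ℝ) = (inferInstance : MeasurableSpace ℝ) := (BorelSpace.measurable_eq).symm
  rw [measurable_iff_comap_le, signedMeasureSpace, MeasurableSpace.comap_iSup]
  simp_rw [MeasurableSpace.comap_iSup, MeasurableSpace.comap_comp, iSup_le_iff, hb,
    ← measurable_iff_comap_le]
  rfl

lemma measurable_signedMeasure_eval {B : Set Ω} (hB : MeasurableSet B) :
    Measurable fun z : SignedMeasure Ω => z B :=
  measurable_signedMeasure_iff.mp measurable_id B hB

variable {M : ℕ}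

/-- The signed measures `zᵢ = ∑ aᵢ δ_ω`, the sum being over the points `((s, ω), a)` of `n`. -/
def signedMarks (n : Measure ((ℝ × Ω) × (Fin M → ℝ))) (i : Fin M) : SignedMeasure Ω :=
  (n.withDensityᵥ fun q => q.2 i).map fun q => q.1.2

lemma signedMarks_apply {n : Measure ((ℝ × Ω) × (Fin M → ℝ))} {i : Fin M}
    (h : Integrable (fun q => q.2 i) n) {B : Set Ω} (hB : MeasurableSet B) :
    signedMarks n i B = ∫ q, B.indicator (fun _ => q.2 i) q.1.2 ∂n := by
  rw [signedMarks, VectorMeasure.map_apply _ (by fun_prop) hB,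
    withDensityᵥ_apply h (hB.preimage (by fun_prop)),
    ← integral_indicator (hB.preimage (by fun_prop))]
  rfl

lemma signedMarks_of_not_integrable {n : Measure ((ℝ × Ω) × (Fin M → ℝ))} {i : Fin M}
    (h : ¬ Integrable (fun q => q.2 i) n) : signedMarks n i = 0 := by
  rw [signedMarks, Measure.withDensityᵥ, dif_neg h, VectorMeasure.map_zero]

lemma measurable_indicator_mark {B : Set Ω} (hB : MeasurableSet B) (i : Fin M) :
    Measurable fun q : (ℝ × Ω) × (Fin M → ℝ) => B.indicator (fun _ => q.2 i) q.1.2 := by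
  have : (fun q : (ℝ × Ω) × (Fin M → ℝ) => B.indicator (fun _ => q.2 i) q.1.2) =
      ((fun q : (ℝ × Ω) × (Fin M → ℝ) => q.1.2) ⁻¹' B).indicator fun q => q.2 i := rfl
  rw [this]
  exact Measurable.indicator (by fun_prop) (hB.preimage (by fun_prop))

lemma integrable_mark_iff {n : Measure ((ℝ × Ω) × (Fin M → ℝ))} {i : Fin M} :
    Integrable (fun q => q.2 i) n ↔ ∫⁻ q, ‖q.2 i‖ₑ ∂n < ∞ :=
  ⟨fun h => h.2, fun h => ⟨(by fun_prop : Measurable fun q : (ℝ × Ω) × (Fin M → ℝ) =>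
    q.2 i).aestronglyMeasurable, h⟩⟩

lemma integrable_indicator_mark {n : Measure ((ℝ × Ω) × (Fin M → ℝ))} {i : Fin M}
    (h : Integrable (fun q => q.2 i) n) {B : Set Ω} (hB : MeasurableSet B) :
    Integrable (fun q => B.indicator (fun _ => q.2 i) q.1.2) n :=
  h.indicator (hB.preimage (by fun_prop : Measurable fun q : (ℝ × Ω) × (Fin M → ℝ) => q.1.2))

lemma measurable_signedMarks :
    Measurable fun (n : Measure ((ℝ × Ω) × (Fin M → ℝ))) i => signedMarks n i := by
  refine measurable_pi_lambda _ fun i => measurable_signedMeasure_iff.mpr fun B hB => ?_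
  have hI : MeasurableSet {n : Measure ((ℝ × Ω) × (Fin M → ℝ)) | ∫⁻ q, ‖q.2 i‖ₑ ∂n < ∞} :=
    measurableSet_lt (Measure.measurable_lintegral (by fun_prop)) measurable_const
  have hm := measurable_indicator_mark hB i
  -- A nonintegrable mark gives the zero signed measure by default. On the measurable set of
  -- integrability the value is a difference of two lower integrals, each measurable in $n$.
  have : (fun n : Measure ((ℝ × Ω) × (Fin M → ℝ)) => signedMarks n i B) =
      {n : Measure ((ℝ × Ω) × (Fin M → ℝ)) | ∫⁻ q, ‖q.2 i‖ₑ ∂n < ∞}.indicator fun n =>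
        (∫⁻ q, ENNReal.ofReal (B.indicator (fun _ => q.2 i) q.1.2) ∂n).toReal -
        (∫⁻ q, ENNReal.ofReal (-B.indicator (fun _ => q.2 i) q.1.2) ∂n).toReal := by
    ext n
    by_cases hn : ∫⁻ q, ‖q.2 i‖ₑ ∂n < ∞
    · rw [indicator_of_mem (by exact hn), signedMarks_apply (integrable_mark_iff.mpr hn) hB,
        integral_eq_lintegral_pos_part_sub_lintegral_neg_part
          (integrable_indicator_mark (integrable_mark_iff.mpr hn) hB)]
    · rw [indicator_of_notMem (by exact hn),
        signedMarks_of_not_integrable (fun h => hn (integrable_mark_iff.mp h))]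
      rfl
  rw [this]
  refine Measurable.indicator (Measurable.sub ?_ ?_) hI
  · exact (Measure.measurable_lintegral (by fun_prop)).ennreal_toReal
  · exact (Measure.measurable_lintegral (by fun_prop)).ennreal_toReal

lemma dirac_apply_eq_indicator (ω : Ω) (c : ℝ) {B : Set Ω} (hB : MeasurableSet B) :
    VectorMeasure.dirac ω c B = B.indicator (fun _ => c) ω := by
  by_cases h : ω ∈ B <;> simp [h, hB]

lemma assemble_apply {K : ℕ} (x : Fin K → (Fin M → ℝ) × Ω) (i : Fin M) {B : Set Ω}
    (hB : MeasurableSet B) :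
    assemble M K x i B = ∑ l, B.indicator (fun _ => (x l).1 i) (x l).2 := by
  have h : (assemble M K x i : Set Ω → ℝ) =
      ∑ l, (VectorMeasure.dirac (x l).2 ((x l).1 i) : Set Ω → ℝ) := by
    rw [assemble]
    exact FunLike.coe_sum _ _
  rw [h, Finset.sum_apply]
  exact Finset.sum_congr rfl fun l _ => dirac_apply_eq_indicator _ _ hB

lemma measurable_assemble (M K : ℕ) : Measurable (assemble (Ω := Ω) M K) := by
  refine measurable_pi_lambda _ fun i => measurable_signedMeasure_iff.mpr fun B hB => ?_
  simp_rw [assemble_apply _ i hB]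
  refine Finset.measurable_sum _ fun l _ => ?_
  have : (fun x : Fin K → (Fin M → ℝ) × Ω => B.indicator (fun _ => (x l).1 i) (x l).2) =
      ((fun x : Fin K → (Fin M → ℝ) × Ω => (x l).2) ⁻¹' B).indicator fun x => (x l).1 i := rfl
  rw [this]
  exact Measurable.indicator (by fun_prop) (hB.preimage (by fun_prop))

/-- The unmarked points, possibly infinitely many, carry the mark $0$ and contribute nothing;
finitely many marked points remain, so integrability is automatic. -/
lemma signedMarks_combine {K : ℕ} (q : Measure (ℝ × Ω) × (Fin K → ((Fin M → ℝ) × Ω) × ℝ)) :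
    signedMarks (combine q) = assemble M K fun l => (q.2 l).1 := by
  have hsm : ∀ B, MeasurableSet B → ∀ i : Fin M, StronglyMeasurable
      fun q : (ℝ × Ω) × (Fin M → ℝ) => B.indicator (fun _ => q.2 i) q.1.2 :=
    fun B hB i => (measurable_indicator_mark hB i).stronglyMeasurable
  have hI1 : ∀ i, Integrable (fun q : (ℝ × Ω) × (Fin M → ℝ) => q.2 i)
      (q.1.map fun p => (p, 0)) := fun i => by
    rw [integrable_mark_iff, lintegral_map (by fun_prop) (by fun_prop)]
    simp
  have hI2 : ∀ i l, Integrable (fun q : (ℝ × Ω) × (Fin M → ℝ) => q.2 i)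
      (Measure.dirac (toMarked (q.2 l))) := fun i l => by
    rw [integrable_mark_iff, lintegral_dirac' _ (by fun_prop)]
    exact enorm_lt_top
  have hI3 : ∀ i, Integrable (fun q : (ℝ × Ω) × (Fin M → ℝ) => q.2 i)
      (∑ l, Measure.dirac (toMarked (q.2 l))) := fun i =>
    integrable_finsetSum_measure.mpr fun l _ => hI2 i l
  ext i B hB
  rw [combine, signedMarks_apply ((hI1 i).add_measure (hI3 i)) hB, integral_add_measure
    (integrable_indicator_mark (hI1 i) hB) (integrable_indicator_mark (hI3 i) hB),
    integral_finsetSum_measure fun l _ => integrable_indicator_mark (hI2 i l) hB,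
    integral_map (by fun_prop) (hsm B hB i).aestronglyMeasurable, assemble_apply _ _ hB]
  have h0 : ∀ p : ℝ × Ω, B.indicator (fun _ => (0 : ℝ)) p.2 = 0 := fun p => by simp
  simp only [Pi.zero_apply, h0, integral_zero, zero_add]
  refine Finset.sum_congr rfl fun l _ => ?_
  rw [integral_dirac' _ _ (hsm B hB i)]
  rfl

lemma map_fst_combine {K : ℕ} (q : Measure (ℝ × Ω) × (Fin K → ((Fin M → ℝ) × Ω) × ℝ)) :
    (combine q).map Prod.fst = q.1 + ∑ l, Measure.dirac ((q.2 l).2, (q.2 l).1.2) := by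
  refine Measure.ext_of_lintegral _ fun f hf => ?_
  rw [lintegral_map hf measurable_fst, lintegral_combine _ (by fun_prop), lintegral_add_measure,
    lintegral_finsetSum_measure]
  simp_rw [lintegral_dirac' _ hf]
  rfl

variable {S : Type*} [MeasurableSpace S] {P : Measure S} {G : Kernel ℝ ℝ} [IsMarkovKernel G]
  {ν : Measure (ℝ × Ω)} {τ : ℕ → S → ℝ} {w : ℕ → S → Ω} {A : Fin M → ℕ → S → ℝ}
  {N : S → Measure (ℝ × Ω)} {μ : S → Measure Ω} {Z : Fin M → S → SignedMeasure Ω}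

lemma IsIBPModel.Z_ae_eq (h : IsIBPModel P G ν M τ w A N μ Z) :
    ∀ᵐ s ∂P, (fun i => Z i s) = signedMarks (markedPoints τ w A s) := by
  filter_upwards [h.Z_eq] with s hs
  have hd : ∀ (B : Set Ω) (hB : MeasurableSet B) i (k : {k : ℕ // 0 < τ k s}),
      ∫ q, B.indicator (fun _ => q.2 i) q.1.2
        ∂(Measure.dirac ((τ k s, w k s), fun i => A i k s)) =
      B.indicator (fun _ => A i k s) (w k s) := fun B hB i k =>
    integral_dirac' _ _ (measurable_indicator_mark hB i).stronglyMeasurable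
  have hI : ∀ i, Integrable (fun q => q.2 i) (markedPoints τ w A s) := fun i => by
    -- Unconditional summability in $\mathbb R$ is absolute, so the case $B=\Omega$ gives
    -- integrability of the marks and excludes the default value of `signedMarks`.
    have hsum := (hs i univ .univ).summable.norm
    simp only [indicator_univ] at hsum
    refine integrable_sum_measure (fun k => ?_) ?_
    · rw [integrable_mark_iff, lintegral_dirac' _ (by fun_prop)]
      exact enorm_lt_top
    · refine hsum.congr fun k => ?_
      rw [integral_dirac' _ _ (by
        exact (by fun_prop : Measurable fun q : (ℝ × Ω) × (Fin M → ℝ) =>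
          ‖q.2 i‖).stronglyMeasurable)]
  ext i B hB
  rw [signedMarks_apply (hI i) hB]
  have := hasSum_integral_measure (integrable_indicator_mark (hI i) hB)
  simp_rw [hd B hB i] at this
  exact (hs i B hB).unique this

lemma IsIBPModel.N_ae_eq (h : IsIBPModel P G ν M τ w A N μ Z) :
    ∀ᵐ s ∂P, N s = (markedPoints τ w A s).map Prod.fst := by
  filter_upwards [h.N_eq] with s hs
  rw [hs, map_fst_markedPoints]

/-- The pair `(z, n)` made of the unmarked points `q.1` and the marked points `q.2 l`. -/
def observe (M K : ℕ) (q : Measure (ℝ × Ω) × (Fin K → ((Fin M → ℝ) × Ω) × ℝ)) :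
    (Fin M → SignedMeasure Ω) × Measure (ℝ × Ω) :=
  (assemble M K fun l => (q.2 l).1, q.1 + ∑ l, Measure.dirac ((q.2 l).2, (q.2 l).1.2))

lemma measurable_observe (M K : ℕ) : Measurable (observe (Ω := Ω) M K) := by
  refine ((measurable_assemble M K).comp (by fun_prop)).prodMk (measurable_fst.add ?_)
  exact Finset.measurable_sum _ fun l _ => Measure.measurable_dirac.comp (by fun_prop)

variable [IsProbabilityMeasure P] {ρ : ℝ → Ω → ℝ≥0∞} {B0 : Measure Ω}

/-- The law of the unmarked points. -/
def unmarkedLaw (P : Measure S) (τ : ℕ → S → ℝ) (w : ℕ → S → Ω) (A : Fin M → ℕ → S → ℝ) :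
    Measure (Measure (ℝ × Ω)) :=
  P.map fun s => unmarkedPart (markedPoints τ w A s)

lemma IsIBPModel.isProbabilityMeasure_unmarkedLaw (h : IsIBPModel P G ν M τ w A N μ Z) :
    IsProbabilityMeasure (unmarkedLaw P τ w A) :=
  Measure.isProbabilityMeasure_map
    (measurable_unmarkedPart.comp h.measurable_markedPoints).aemeasurable

/-- The model itself supplies the law of $N_M$: that of the points with all marks zero, realized
canonically by the identity map. -/
lemma IsIBPModel.isPRM_unmarkedLaw [SFinite B0] [SigmaFinite (levyMeasure ρ B0)]
    (h : IsIBPModel P G (levyMeasure ρ B0) M τ w A N μ Z)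
    (hρ : Measurable (Function.uncurry ρ)) :
    IsPRM (unmarkedLaw P τ w A) id (levyMeasure (rhoM G ρ M) B0) := by
  have := h.isProbabilityMeasure_unmarkedLaw
  refine HasPoissonLaplace.isPRM measurable_id fun f hf => ?_
  have hm : Measurable fun s => unmarkedPart (markedPoints τ w A s) :=
    measurable_unmarkedPart.comp h.measurable_markedPoints
  rw [unmarkedLaw, lintegral_map (by
      exact measurable_expNeg.comp (Measure.measurable_lintegral hf)) hm]
  exact h.hasPoissonLaplace_markedPoints.unmarked hρ f hf

/-- The joint law of the observations and the points. -/
lemma IsIBPModel.map_Z_N [SFinite B0] [SigmaFinite (levyMeasure ρ B0)]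
    (h : IsIBPModel P G (levyMeasure ρ B0) M τ w A N μ Z)
    (hρ : Measurable (Function.uncurry ρ))
    (hG : ∀ᵐ p ∂(levyMeasure ρ B0), 0 < G p.1 {0}) (hΨ : Psi G ρ B0 M ≠ ∞) :
    P.map (fun s => ((fun i => Z i s), N s)) =
      ENNReal.ofReal (Real.exp (-(Psi G ρ B0 M).toReal)) •
        Measure.sum fun K : ℕ => ((K.factorial : ℝ≥0∞)⁻¹) •
          ((unmarkedLaw P τ w A).prod
            (Measure.pi fun _ : Fin K => featureJump G ρ B0 M)).map (observe M K) := by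
  have hm := h.measurable_markedPoints
  let F : Measure ((ℝ × Ω) × (Fin M → ℝ)) → (Fin M → SignedMeasure Ω) × Measure (ℝ × Ω) :=
    fun n => (signedMarks n, n.map Prod.fst)
  have hF : Measurable F :=
    measurable_signedMarks.prodMk (Measure.measurable_map _ measurable_fst)
  have h1 : P.map (fun s => ((fun i => Z i s), N s)) = (P.map (markedPoints τ w A)).map F := by
    rw [Measure.map_map hF hm]
    refine Measure.map_congr ?_
    filter_upwards [h.Z_ae_eq, h.N_ae_eq] with s h1 h2
    rw [h1, h2]
    rfl
  rw [h1, map_markedPoints_eq hρ hG hΨ hm h.hasPoissonLaplace_markedPoints, markedLaw,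
    Measure.map_smul, Measure.map_sum hF.aemeasurable]
  congr 2
  ext1 K
  rw [Measure.map_smul, Measure.map_map hF (by fun_prop)]
  congr 2
  ext1 q
  exact Prod.ext (signedMarks_combine q) (map_fst_combine q)

end

/-! ### Recovering the features from the signed measures -/

section


section CountablySeparated

variable {Ω : Type*} [MeasurableSpace Ω]

/-- Signed measures which agree on a generating π-system and on the whole space are equal. -/
lemma signedMeasure_ext_of_generateFrom {C : Set (Set Ω)}
    (hC : ‹MeasurableSpace Ω› = MeasurableSpace.generateFrom C) (hpi : IsPiSystem C)
    {v v' : SignedMeasure Ω} (huniv : v univ = v' univ) (h : ∀ B ∈ C, v B = v' B) : v = v' := by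
  ext B hB
  induction B, hB using MeasurableSpace.induction_on_inter hC hpi with
  | empty => simp
  | basic B hB => exact h B hB
  | compl B hB ih => rw [VectorMeasure.of_compl hB, VectorMeasure.of_compl hB, huniv, ih]
  | iUnion f hd hm ih =>
    have h1 := v.m_iUnion hm hd
    simp_rw [ih] at h1
    exact h1.unique (v'.m_iUnion hm hd)

/-- Countably many evaluations determine a signed measure. -/
lemma exists_countable_determining [StandardBorelSpace Ω] :
    ∃ B : ℕ → Set Ω, (∀ n, MeasurableSet (B n)) ∧
      ∀ v v' : SignedMeasure Ω, (∀ n, v (B n) = v' (B n)) → v = v' := by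
  have hφ := measurableEmbedding_embeddingReal Ω
  let C : Set (Set Ω) := {s | ∃ t ∈ ⋃ a : ℚ, {Iic (a : ℝ)}, embeddingReal Ω ⁻¹' t = s}
  have hpi : IsPiSystem C := Real.isPiSystem_Iic_rat.comap _
  have hgen : ‹MeasurableSpace Ω› = MeasurableSpace.generateFrom C := by
    rw [← hφ.comap_eq, BorelSpace.measurable_eq (α := ℝ), Real.borel_eq_generateFrom_Iic_rat,
      MeasurableSpace.comap_generateFrom]
    rfl
  have hcount : (insert univ C).Countable := by
    have hC : C = (embeddingReal Ω ⁻¹' ·) '' ⋃ a : ℚ, {Iic (a : ℝ)} := rfl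
    rw [hC]
    exact ((countable_iUnion fun a => countable_singleton _).image _).insert _
  obtain ⟨B, hB⟩ := hcount.exists_eq_range (insert_nonempty _ _)
  refine ⟨B, fun n => ?_, fun v v' h => ?_⟩
  · have : B n ∈ insert univ C := hB ▸ mem_range_self n
    rcases this with h | h
    · rw [h]; exact .univ
    · rw [hgen]; exact MeasurableSpace.measurableSet_generateFrom h
  · have key : ∀ D ∈ insert univ C, v D = v' D := by
      rw [hB]
      rintro _ ⟨n, rfl⟩
      exact h n
    exact signedMeasure_ext_of_generateFrom hgen hpi (key _ (mem_insert _ _))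
      fun D hD => key D (mem_insert_of_mem _ hD)

/-- Countable separation of the target is what the Lusin–Souslin theorem needs for injective
measurable images to be measurable. -/
instance countablySeparated_signedMeasure [StandardBorelSpace Ω] (M : ℕ) :
    MeasurableSpace.CountablySeparated (Fin M → SignedMeasure Ω) := by
  obtain ⟨B, hBm, hB⟩ := exists_countable_determining (Ω := Ω)
  refine ⟨⟨⟨range fun p : Fin M × ℕ × ℚ => {z : Fin M → SignedMeasure Ω | z p.1 (B p.2.1) < p.2.2},
    countable_range _, ?_, ?_⟩⟩⟩
  · rintro _ ⟨p, rfl⟩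
    exact measurableSet_lt ((measurable_signedMeasure_eval (hBm _)).comp (measurable_pi_apply _))
      measurable_const
  · intro z _ z' _ h
    ext1 i
    exact hB _ _ fun n => eq_of_forall_lt_rat_iff_lt fun q => h _ ⟨(i, n, q), rfl⟩

end CountablySeparated

section Tuples

variable {Ω : Type*} [MeasurableSpace Ω] {M K : ℕ}

lemma assemble_comp_perm (x : Fin K → (Fin M → ℝ) × Ω) (σ : Equiv.Perm (Fin K)) :
    assemble M K (x ∘ σ) = assemble M K x := by
  ext1 i
  exact Equiv.sum_comp σ fun l => VectorMeasure.dirac (x l).2 ((x l).1 i)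

variable [StandardBorelSpace Ω]

/-- The `K`-tuples of distinct features with nonzero values. -/
def validTuples (Ω : Type*) (M K : ℕ) : Set (Fin K → (Fin M → ℝ) × Ω) :=
  {x | (∀ l, (x l).1 ≠ 0) ∧ Function.Injective fun l => (x l).2}

/-- The `K`-tuples of features with nonzero values, in increasing order. -/
def orderedTuples (Ω : Type*) [MeasurableSpace Ω] [StandardBorelSpace Ω] (M K : ℕ) :
    Set (Fin K → (Fin M → ℝ) × Ω) :=
  {x | (∀ l, (x l).1 ≠ 0) ∧ StrictMono fun l => embeddingReal Ω (x l).2}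

lemma orderedTuples_subset : orderedTuples Ω M K ⊆ validTuples Ω M K :=
  fun _ hx => ⟨hx.1, fun _ _ h => hx.2.injective (congrArg (embeddingReal Ω) h)⟩

lemma measurableSet_orderedTuples : MeasurableSet (orderedTuples Ω M K) := by
  have hφ := (measurableEmbedding_embeddingReal Ω).measurable
  have : orderedTuples Ω M K = (⋂ l, {x | (x l).1 ≠ 0}) ∩
      ⋂ l, ⋂ l', {x | l < l' → embeddingReal Ω (x l).2 < embeddingReal Ω (x l').2} := by
    ext x
    simp [orderedTuples, StrictMono]
  rw [this]
  refine (MeasurableSet.iInter fun l => ?_).inter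
    (MeasurableSet.iInter fun l => MeasurableSet.iInter fun l' => ?_)
  · exact ((by fun_prop : Measurable fun x : Fin K → (Fin M → ℝ) × Ω => (x l).1)
      (measurableSet_singleton 0)).compl
  · by_cases h : l < l'
    · simp only [h, true_imp_iff]
      exact measurableSet_lt (by fun_prop) (by fun_prop)
    · simp [h]

lemma assemble_singleton {x : Fin K → (Fin M → ℝ) × Ω} (hx : x ∈ validTuples Ω M K)
    (l : Fin K) (i : Fin M) : assemble M K x i {(x l).2} = (x l).1 i := by
  rw [assemble_apply _ _ (measurableSet_singleton _), Finset.sum_eq_single l]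
  · simp
  · intro l' _ hl
    rw [indicator_of_notMem]
    exact fun hc => hl (hx.2 hc)
  · simp

lemma featureAt_assemble {x : Fin K → (Fin M → ℝ) × Ω} (hx : x ∈ validTuples Ω M K)
    (l : Fin K) : featureAt (assemble M K x) (x l).2 = x l :=
  Prod.ext (funext fun i => assemble_singleton hx l i) rfl

lemma features_assemble {x : Fin K → (Fin M → ℝ) × Ω} (hx : x ∈ validTuples Ω M K) :
    features (assemble M K x) = range fun l => (x l).2 := by
  ext ω
  constructor
  · rintro ⟨i, hi⟩
    by_contra hc
    apply hi
    rw [assemble_apply _ _ (measurableSet_singleton _)]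
    refine Finset.sum_eq_zero fun l _ => ?_
    rw [indicator_of_notMem]
    exact fun h => hc ⟨l, h⟩
  · rintro ⟨l, rfl⟩
    obtain ⟨i, hi⟩ := Function.ne_iff.mp (hx.1 l)
    refine ⟨i, ?_⟩
    rw [assemble_singleton hx]
    exact hi

/-- The signed measures determine the set of features, the increasing order fixes their numbering,
and the masses at the features give the values. -/
lemma assemble_injOn : InjOn (assemble (Ω := Ω) M K) (orderedTuples Ω M K) := by
  intro x hx y hy hxy
  have hx' := orderedTuples_subset hx
  have hy' := orderedTuples_subset hy
  have hr : range (fun l => (x l).2) = range fun l => (y l).2 := by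
    rw [← features_assemble hx', ← features_assemble hy', hxy]
  have hr' : (fun l => embeddingReal Ω (x l).2) = fun l => embeddingReal Ω (y l).2 := by
    rw [← hx.2.range_inj hy.2, range_comp' (embeddingReal Ω), range_comp' (embeddingReal Ω), hr]
  ext1 l
  have hl : (x l).2 = (y l).2 :=
    (measurableEmbedding_embeddingReal Ω).injective (congrFun hr' l)
  rw [← featureAt_assemble hx' l, ← featureAt_assemble hy' l, hxy, hl]

lemma exists_ordered {x : Fin K → (Fin M → ℝ) × Ω} (hx : x ∈ validTuples Ω M K) :
    ∃ y ∈ orderedTuples Ω M K, assemble M K y = assemble M K x := by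
  let f : Fin K → ℝ := fun l => embeddingReal Ω (x l).2
  have hf : Function.Injective f :=
    (measurableEmbedding_embeddingReal Ω).injective.comp hx.2
  refine ⟨x ∘ Tuple.sort f, ⟨fun l => hx.1 _, ?_⟩, assemble_comp_perm _ _⟩
  exact (Tuple.monotone_sort f).strictMono_of_injective (hf.comp (Tuple.sort f).injective)

/-- The `z` which come from `K` distinct features. -/
def observedSet (Ω : Type*) [MeasurableSpace Ω] [StandardBorelSpace Ω] (M K : ℕ) :
    Set (Fin M → SignedMeasure Ω) :=
  assemble M K '' orderedTuples Ω M K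

/-- This is Lusin–Souslin: `assemble` is measurable and injective on the ordered tuples. -/
lemma measurableSet_observedSet : MeasurableSet (observedSet Ω M K) :=
  measurableSet_orderedTuples.image_of_measurable_injOn (measurable_assemble M K) assemble_injOn

lemma assemble_mem_observedSet {x : Fin K → (Fin M → ℝ) × Ω} (hx : x ∈ validTuples Ω M K) :
    assemble M K x ∈ observedSet Ω M K := by
  obtain ⟨y, hy, h⟩ := exists_ordered hx
  exact ⟨y, hy, h⟩

lemma finite_features_of_mem {z : Fin M → SignedMeasure Ω} (hz : z ∈ observedSet Ω M K) :
    (features z).Finite := by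
  obtain ⟨x, hx, rfl⟩ := hz
  rw [features_assemble (orderedTuples_subset hx)]
  exact finite_range _

/-- A measurable function of the ordered tuples is a measurable function of `z`. -/
lemma measurableSet_inter_observedSet {Y : Type*} [MeasurableSpace Y]
    {g : (Fin M → SignedMeasure Ω) → Y} {t : (Fin K → (Fin M → ℝ) × Ω) → Y} (ht : Measurable t)
    (h : ∀ x ∈ validTuples Ω M K, g (assemble M K x) = t x) {E : Set Y} (hE : MeasurableSet E) :
    MeasurableSet (g ⁻¹' E ∩ observedSet Ω M K) := by
  have : g ⁻¹' E ∩ observedSet Ω M K = assemble M K '' (t ⁻¹' E ∩ orderedTuples Ω M K) := by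
    ext z
    constructor
    · rintro ⟨hz, x, hx, rfl⟩
      refine ⟨x, ⟨?_, hx⟩, rfl⟩
      rwa [mem_preimage, ← h x (orderedTuples_subset hx)]
    · rintro ⟨x, ⟨hxE, hx⟩, rfl⟩
      refine ⟨?_, x, hx, rfl⟩
      rwa [mem_preimage, h x (orderedTuples_subset hx)]
  rw [this]
  exact ((ht hE).inter measurableSet_orderedTuples).image_of_measurable_injOn
    (measurable_assemble M K) (assemble_injOn.mono inter_subset_right)

end Tuples

end

/-! ### The posterior as a kernel and the joint law -/

section


section CRM

variable {Ω : Type*} [MeasurableSpace Ω]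

lemma lintegral_crmOf (n : Measure (ℝ × Ω)) {f : Ω → ℝ≥0∞} (hf : Measurable f) :
    ∫⁻ ω, f ω ∂(crmOf n) = ∫⁻ p, ENNReal.ofReal p.1 * f p.2 ∂n := by
  rw [crmOf, lintegral_map hf measurable_snd,
    lintegral_withDensity_eq_lintegral_mul _ (by fun_prop) (by fun_prop)]
  rfl

lemma measurable_crmOf : Measurable (crmOf (Ω := Ω)) := by
  refine Measure.measurable_of_measurable_coe _ fun B hB => ?_
  simp_rw [← lintegral_indicator_one hB, lintegral_crmOf _ (measurable_one.indicator hB)]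
  exact Measure.measurable_lintegral (Measurable.mul (by fun_prop)
    ((measurable_one.indicator hB).comp measurable_snd))

lemma crmOf_add_sum {ι : Type*} (n : Measure (ℝ × Ω)) (t : ι → ℝ) (w : ι → Ω) :
    crmOf (n + Measure.sum fun i => Measure.dirac (t i, w i)) =
      crmOf n + Measure.sum fun i => ENNReal.ofReal (t i) • Measure.dirac (w i) := by
  refine Measure.ext_of_lintegral _ fun f hf => ?_
  rw [lintegral_crmOf _ hf, lintegral_add_measure, lintegral_add_measure, lintegral_crmOf _ hf,
    lintegral_sum_measure, lintegral_sum_measure]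
  congr 1
  refine tsum_congr fun i => ?_
  rw [lintegral_smul_measure, lintegral_dirac' _ (by fun_prop), lintegral_dirac' _ hf,
    smul_eq_mul]

lemma measurable_add_sum_dirac {ι α : Type*} [Countable ι] [MeasurableSpace α]
    {f : α → Measure (ℝ × Ω)} (hf : Measurable f) {t : ι → α → ℝ} (ht : ∀ i, Measurable (t i))
    {w : ι → α → Ω} (hw : ∀ i, Measurable (w i)) :
    Measurable fun a => f a + Measure.sum fun i => Measure.dirac (t i a, w i a) := by
  refine hf.add (Measure.measurable_of_measurable_coe _ fun C hC => ?_)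
  simp_rw [Measure.sum_apply _ hC]
  refine Measurable.tsum fun i => ?_
  exact (Measure.measurable_coe hC).comp
    (Measure.measurable_dirac.comp ((ht i).prodMk (hw i)))

end CRM

variable {Ω : Type*} [MeasurableSpace Ω] {M K : ℕ}
  {J : Kernel ((Fin M → ℝ) × Ω) ℝ} [IsMarkovKernel J]

/-- Independent jumps at the features of a tuple. -/
def tupleKernel (J : Kernel ((Fin M → ℝ) × Ω) ℝ) [IsMarkovKernel J] (K : ℕ) :
    Kernel (Fin K → (Fin M → ℝ) × Ω) (Fin K → ℝ) where
  toFun x := Measure.pi fun l => J (x l)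
  measurable' := measurable_measure_pi (fun l (x : Fin K → (Fin M → ℝ) × Ω) => J (x l)) fun l =>
    J.measurable.comp (measurable_pi_apply l)

lemma tupleKernel_apply (x : Fin K → (Fin M → ℝ) × Ω) :
    tupleKernel J K x = Measure.pi fun l => J (x l) := rfl

instance : IsMarkovKernel (tupleKernel J K) :=
  ⟨fun x => by rw [tupleKernel_apply]; infer_instance⟩

/-- The law of `N_M + ∑ δ_(J l, ω l)` for a tuple of features. -/
def tuplePosterior (R : Measure (Measure (ℝ × Ω))) (J : Kernel ((Fin M → ℝ) × Ω) ℝ)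
    [IsMarkovKernel J] (x : Fin K → (Fin M → ℝ) × Ω) : Measure (Measure (ℝ × Ω)) :=
  (R.prod (tupleKernel J K x)).map fun q => q.1 + ∑ l, Measure.dirac (q.2 l, (x l).2)

lemma measurable_add_tuple :
    Measurable fun q : (Fin K → (Fin M → ℝ) × Ω) × (Fin K → ℝ) × Measure (ℝ × Ω) =>
      q.2.2 + ∑ l, Measure.dirac (q.2.1 l, (q.1 l).2) := by
  refine Measurable.add (by fun_prop) ?_
  exact Finset.measurable_sum _ fun l _ => Measure.measurable_dirac.comp (by fun_prop)

lemma lintegral_tuplePosterior (R : Measure (Measure (ℝ × Ω))) [SFinite R]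
    (x : Fin K → (Fin M → ℝ) × Ω) {f : Measure (ℝ × Ω) → ℝ≥0∞} (hf : Measurable f) :
    ∫⁻ n, f n ∂(tuplePosterior R J x) =
      ∫⁻ t, ∫⁻ n, f (n + ∑ l, Measure.dirac (t l, (x l).2)) ∂(R) ∂(tupleKernel J K x) := by
  have hm : Measurable fun q : Measure (ℝ × Ω) × (Fin K → ℝ) =>
      q.1 + ∑ l, Measure.dirac (q.2 l, (x l).2) :=
    measurable_add_tuple.comp (measurable_const.prodMk (measurable_snd.prodMk measurable_fst))
  rw [tuplePosterior, lintegral_map hf hm,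
    lintegral_prod_symm _ (by exact (hf.comp hm).aemeasurable)]

lemma measurable_tuplePosterior (R : Measure (Measure (ℝ × Ω))) [SFinite R] :
    Measurable (tuplePosterior (K := K) R J) := by
  refine Measure.measurable_of_measurable_coe _ fun C hC => ?_
  have h0 : Measurable (C.indicator (1 : Measure (ℝ × Ω) → ℝ≥0∞)) :=
    measurable_one.indicator hC
  have h1 := h0.comp
    (measurable_add_tuple (Ω := Ω) (M := M) (K := K))
  have h2 : Measurable fun p : (Fin K → (Fin M → ℝ) × Ω) × (Fin K → ℝ) =>
      ∫⁻ n, C.indicator (1 : Measure (ℝ × Ω) → ℝ≥0∞)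
        (n + ∑ l, Measure.dirac (p.2 l, (p.1 l).2)) ∂(R) :=
    (h1.comp ((measurable_fst.comp measurable_fst).prodMk
      ((measurable_snd.comp measurable_fst).prodMk measurable_snd))).lintegral_prod_right'
      (f := fun z : ((Fin K → (Fin M → ℝ) × Ω) × (Fin K → ℝ)) × Measure (ℝ × Ω) =>
        C.indicator (1 : Measure (ℝ × Ω) → ℝ≥0∞)
          (z.2 + ∑ l, Measure.dirac (z.1.2 l, (z.1.1 l).2)))
  simp_rw [← lintegral_indicator_one hC,
    lintegral_tuplePosterior R _ (measurable_one.indicator hC)]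
  exact h2.lintegral_kernel_prod_right' (κ := tupleKernel J K)

lemma isProbabilityMeasure_tuplePosterior (R : Measure (Measure (ℝ × Ω)))
    [IsProbabilityMeasure R] (x : Fin K → (Fin M → ℝ) × Ω) :
    IsProbabilityMeasure (tuplePosterior R J x) := by
  refine ⟨?_⟩
  rw [← lintegral_one, lintegral_tuplePosterior R x measurable_const]
  simp

section Standard

lemma posteriorμ_eq (R : Measure (Measure (ℝ × Ω))) [IsProbabilityMeasure R]
    {z : Fin M → SignedMeasure Ω} (hz : (features z).Finite) :
    posteriorμ (R.map crmOf) J z = (posteriorN R J z).map crmOf := by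
  have : Countable (features z) := hz.countable
  have hN : Measurable fun q : Measure (ℝ × Ω) × (features z → ℝ) =>
      q.1 + Measure.sum fun ω : features z => Measure.dirac (q.2 ω, (ω : Ω)) :=
    measurable_add_sum_dirac measurable_fst (fun ω => by fun_prop) fun ω => measurable_const
  -- Both factors are written as pushforwards so that the product of pushforwards becomes one
  -- pushforward.
  have hid : jumpsLaw J z = (jumpsLaw J z).map id := Measure.map_id.symm
  have : IsProbabilityMeasure (jumpsLaw J z) := by rw [jumpsLaw]; infer_instance
  have hμ : Measurable fun q : Measure Ω × (features z → ℝ) =>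
      q.1 + Measure.sum fun ω : features z =>
        ENNReal.ofReal (q.2 ω) • Measure.dirac (ω : Ω) := by
    refine measurable_fst.add (Measure.measurable_of_measurable_coe _ fun C hC => ?_)
    simp_rw [Measure.sum_apply _ hC, Measure.smul_apply]
    exact Measurable.tsum fun ω => Measurable.mul_const (by fun_prop) _
  rw [posteriorμ, posteriorN, Measure.map_map measurable_crmOf hN]
  conv_lhs => rw [hid]
  rw [Measure.map_prod_map _ _ measurable_crmOf measurable_id, Measure.map_map hμ
    (measurable_crmOf.prodMap measurable_id)]
  congr 1
  ext1 q
  exact (crmOf_add_sum q.1 q.2 fun ω : features z => (ω : Ω)).symm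

variable [StandardBorelSpace Ω]

/-- For distinct features with nonzero values, $l\mapsto\omega_l$ is a bijection onto the feature
set; relabelling the jumps along it turns the intrinsic description into the tuple one. -/
lemma posteriorN_assemble (R : Measure (Measure (ℝ × Ω))) [IsProbabilityMeasure R]
    {x : Fin K → (Fin M → ℝ) × Ω} (hx : x ∈ validTuples Ω M K) :
    posteriorN R J (assemble M K x) = tuplePosterior R J x := by
  have hf := features_assemble hx
  let e : Fin K ≃ features (assemble M K x) :=
    (Equiv.ofInjective _ hx.2).trans (Equiv.setCongr hf.symm)
  have he : ∀ l, ((e l : features (assemble M K x)) : Ω) = (x l).2 := fun l => rfl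
  have : Fintype (features (assemble M K x)) := Fintype.ofEquiv _ e
  have hJ : ∀ l, J (featureAt (assemble M K x) (e l)) = J (x l) := fun l => by
    rw [he, featureAt_assemble hx]
  let c := MeasurableEquiv.piCongrLeft (fun _ : features (assemble M K x) => ℝ) e
  have hjl : jumpsLaw J (assemble M K x) = (tupleKernel J K x).map c := by
    rw [jumpsLaw, ← Measure.infinitePi_map_piCongrLeft (X := fun _ => ℝ)
      (fun ω : features (assemble M K x) => J (featureAt (assemble M K x) ω)) e,
      Measure.infinitePi_eq_pi, tupleKernel_apply]
    simp_rw [hJ]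
    rfl
  have hR : R = R.map id := Measure.map_id.symm
  rw [posteriorN, hjl, tuplePosterior]
  conv_lhs => rw [hR]
  rw [Measure.map_prod_map _ _ measurable_id c.measurable, Measure.map_map
    (measurable_add_sum_dirac measurable_fst (fun ω => by fun_prop) fun ω => measurable_const)
    (measurable_id.prodMap c.measurable)]
  congr 1
  ext1 q
  have hc : ∀ l, c q.2 (e l) = q.2 l := fun l =>
    Equiv.piCongrLeft_apply_apply (fun _ : features (assemble M K x) => ℝ) e q.2 l
  simp only [Function.comp_apply, Prod.map_fst, Prod.map_snd, id_eq]
  rw [Measure.sum_fintype, ← e.sum_comp]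
  simp_rw [hc, he]

open Classical in
/-- The posterior law of the points, as a kernel. -/
lemma exists_posteriorKernel (R : Measure (Measure (ℝ × Ω))) [IsProbabilityMeasure R]
    (J : Kernel ((Fin M → ℝ) × Ω) ℝ) [IsMarkovKernel J] :
    ∃ κ : Kernel (Fin M → SignedMeasure Ω) (Measure (ℝ × Ω)), IsMarkovKernel κ ∧
      ∀ z ∈ ⋃ K, observedSet Ω M K, κ z = posteriorN R J z := by
  let V : Set (Fin M → SignedMeasure Ω) := ⋃ K, observedSet Ω M K
  have hV : MeasurableSet V := MeasurableSet.iUnion fun K => measurableSet_observedSet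
  -- Off `V` the value is arbitrary, since the law of the observations is carried by `V`.
  let g : (Fin M → SignedMeasure Ω) → Measure (Measure (ℝ × Ω)) := fun z =>
    if z ∈ V then posteriorN R J z else Measure.dirac 0
  have hg : Measurable g := by
    intro E hE
    have : g ⁻¹' E = (⋃ K, posteriorN R J ⁻¹' E ∩ observedSet Ω M K) ∪
        (Vᶜ ∩ {_z | (Measure.dirac 0 : Measure (Measure (ℝ × Ω))) ∈ E}) := by
      rw [← inter_iUnion]
      ext z
      by_cases hz : z ∈ V
      · have hz' : z ∈ ⋃ K, observedSet Ω M K := hz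
        have hgz : g z = posteriorN R J z := if_pos hz
        simp only [mem_preimage, hgz, mem_union, mem_inter_iff, hz', and_true,
          mem_compl_iff, hz, not_true, false_and, or_false]
      · have hz' : z ∉ ⋃ K, observedSet Ω M K := hz
        have hgz : g z = Measure.dirac 0 := if_neg hz
        simp only [mem_preimage, hgz, mem_union, mem_inter_iff, hz', and_false,
          mem_compl_iff, hz, not_false_iff, true_and, false_or]
        rfl
    rw [this]
    refine (MeasurableSet.iUnion fun K => ?_).union (hV.compl.inter (.const _))
    exact measurableSet_inter_observedSet (measurable_tuplePosterior R)
      (fun x hx => posteriorN_assemble R hx) hE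
  refine ⟨⟨g, hg⟩, ⟨fun z => ?_⟩, fun z hz => if_pos hz⟩
  change IsProbabilityMeasure (g z)
  by_cases hz : z ∈ V
  · obtain ⟨K, x, hx, rfl⟩ := mem_iUnion.mp hz
    simp only [g, if_pos hz]
    rw [posteriorN_assemble R (orderedTuples_subset hx)]
    exact isProbabilityMeasure_tuplePosterior R x
  · simp only [g, if_neg hz]
    infer_instance

end Standard

section Joint

/-- Disintegration of a finite product. -/
lemma lintegral_pi_compProd (L : Measure ((Fin M → ℝ) × Ω)) [IsFiniteMeasure L]
    {f : (Fin K → ((Fin M → ℝ) × Ω) × ℝ) → ℝ≥0∞} (hf : Measurable f) :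
    ∫⁻ y, f y ∂(Measure.pi fun _ : Fin K => L ⊗ₘ J) =
      ∫⁻ x, ∫⁻ t, f (fun l => (x l, t l)) ∂(tupleKernel J K x)
        ∂(Measure.pi fun _ : Fin K => L) := by
  let zip : (Fin K → (Fin M → ℝ) × Ω) × (Fin K → ℝ) → (Fin K → ((Fin M → ℝ) × Ω) × ℝ) :=
    fun p l => (p.1 l, p.2 l)
  have hzip : Measurable zip := by
    refine measurable_pi_lambda _ fun l => ?_
    fun_prop
  -- On boxes both sides equal $\prod_l\int J(y,\{s:(y,s)\in C_l\})\,L(dy)$, and boxes determine a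
  -- finite product.
  have h : (Measure.pi fun _ : Fin K => L ⊗ₘ J) =
      ((Measure.pi fun _ : Fin K => L) ⊗ₘ tupleKernel J K).map zip := by
    refine Measure.pi_eq fun C hC => ?_
    rw [Measure.map_apply hzip (.univ_pi hC),
      Measure.compProd_apply ((MeasurableSet.univ_pi hC).preimage hzip)]
    have h1 : ∀ x : Fin K → (Fin M → ℝ) × Ω,
        tupleKernel J K x (Prod.mk x ⁻¹' (zip ⁻¹' univ.pi C)) =
          ∏ l, J (x l) (Prod.mk (x l) ⁻¹' C l) := by
      intro x
      rw [tupleKernel_apply, ← Measure.pi_pi]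
      congr 1
    simp_rw [h1, Measure.compProd_apply (hC _)]
    exact lintegral_pi_prod (fun _ : Fin K => L) (f := fun l y => J y (Prod.mk y ⁻¹' C l))
      fun l => Kernel.measurable_kernel_prodMk_left (hC l)
  rw [h, lintegral_map hf hzip, Measure.lintegral_compProd (by exact hf.comp hzip)]

lemma map_fst_observe [StandardBorelSpace Ω] (R : Measure (Measure (ℝ × Ω)))
    [IsProbabilityMeasure R] (L : Measure ((Fin M → ℝ) × Ω)) [IsFiniteMeasure L] :
    ((R.prod (Measure.pi fun _ : Fin K => L ⊗ₘ J)).map (observe M K)).map Prod.fst =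
      (Measure.pi fun _ : Fin K => L).map (assemble M K) := by
  rw [Measure.map_map measurable_fst (measurable_observe M K)]
  refine Measure.ext_of_lintegral _ fun f hf => ?_
  have ha := hf.comp (measurable_assemble (Ω := Ω) M K)
  rw [lintegral_map hf (measurable_fst.comp (measurable_observe M K)),
    lintegral_map hf (measurable_assemble M K), lintegral_prod_symm _
      (by exact (hf.comp (measurable_fst.comp (measurable_observe M K))).aemeasurable)]
  simp only [Function.comp_apply, observe, lintegral_const, measure_univ, mul_one]
  rw [lintegral_pi_compProd (f := fun y => f (assemble M K fun l => (y l).1)) L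
    (ha.comp (by fun_prop))]
  simp

/-- Disintegrating each factor exposes the tuple $x$ of features, with independent jumps given $x$.
Almost every $x$ is valid, and there $\kappa$ at the assembled observation is the posterior of the
tuple. -/
lemma map_observe_eq_compProd [StandardBorelSpace Ω] (R : Measure (Measure (ℝ × Ω)))
    [IsProbabilityMeasure R] (L : Measure ((Fin M → ℝ) × Ω)) [IsFiniteMeasure L]
    (hL : ∀ᵐ x ∂(Measure.pi fun _ : Fin K => L), x ∈ validTuples Ω M K)
    {κ : Kernel (Fin M → SignedMeasure Ω) (Measure (ℝ × Ω))} [IsMarkovKernel κ]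
    (hκ : ∀ z ∈ ⋃ K, observedSet Ω M K, κ z = posteriorN R J z) :
    (R.prod (Measure.pi fun _ : Fin K => L ⊗ₘ J)).map (observe M K) =
      ((Measure.pi fun _ : Fin K => L).map (assemble M K)) ⊗ₘ κ := by
  refine Measure.ext_of_lintegral _ fun f hf => ?_
  have ho := hf.comp (measurable_observe (Ω := Ω) M K)
  have hin : Measurable fun y : Fin K → ((Fin M → ℝ) × Ω) × ℝ =>
      ∫⁻ n, f (observe M K (n, y)) ∂(R) := ho.lintegral_prod_left'
  rw [lintegral_map hf (measurable_observe M K),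
    lintegral_prod_symm _ (by exact ho.aemeasurable), lintegral_pi_compProd L hin,
    Measure.lintegral_compProd hf, lintegral_map (hf.lintegral_kernel_prod_right')
      (measurable_assemble M K)]
  refine lintegral_congr_ae ?_
  filter_upwards [hL] with x hx
  rw [hκ _ (mem_iUnion.mpr ⟨K, assemble_mem_observedSet hx⟩), posteriorN_assemble R hx,
    lintegral_tuplePosterior (f := fun n => f (assemble M K x, n)) R x
      (hf.comp measurable_prodMk_left)]
  rfl

end Joint

end

/-! ### Distinctness of the features, and densities -/

section


variable {Ω : Type*} [MeasurableSpace Ω] {G : Kernel ℝ ℝ}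
  {ρ : ℝ → Ω → ℝ≥0∞} {B0 : Measure Ω} {M : ℕ}

lemma featureMeasure_ae_ne_zero : ∀ᵐ x ∂(featureMeasure G ρ B0 M), x.1 ≠ 0 := by
  have hne : MeasurableSet {x : (Fin M → ℝ) × Ω | x.1 ≠ 0} :=
    (measurable_fst (measurableSet_singleton 0)).compl
  rw [featureMeasure, ae_map_iff measurable_fst.aemeasurable hne, featureJump]
  exact ae_restrict_mem (hne.preimage measurable_fst)

section DensityBase

variable {lam : Measure ℝ} {g : ℝ → ℝ → ℝ≥0∞}

/-- `δ₀ + λ` on `a ≠ 0`. -/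
def baseMeasure (lam : Measure ℝ) : Measure ℝ := Measure.dirac 0 + lam.restrict {0}ᶜ

instance [SigmaFinite lam] : SigmaFinite (baseMeasure lam) := by
  unfold baseMeasure
  infer_instance

@[fun_prop]
lemma measurable_piA : Measurable (piA G) := G.measurable_coe (measurableSet_singleton 0).compl

/-- The reference measure is $\delta_0$ plus a part not charging $0$, so the density is matched on
the two pieces separately, with value $1$ at $0$. -/
lemma hMeasure_eq_withDensity (hg : Measurable (Function.uncurry g)) {s : ℝ}
    (hs : (G s).restrict {0}ᶜ = (lam.withDensity (g s)).restrict {0}ᶜ) :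
    hMeasure G s = (baseMeasure lam).withDensity fun a => hDensity G g a s := by
  have hgs : Measurable (g s) := hg.comp measurable_prodMk_left
  rw [hMeasure, baseMeasure, withDensity_add_measure, hs,
    restrict_withDensity (measurableSet_singleton 0).compl]
  congr 1
  · have : (Measure.dirac (0 : ℝ)).withDensity (fun a => hDensity G g a s) =
        (Measure.dirac (0 : ℝ)).withDensity 1 := by
      refine withDensity_congr_ae ?_
      rw [Filter.EventuallyEq, ae_dirac_eq]
      simp [hDensity]
    rw [this, withDensity_one]
  · rw [← withDensity_smul _ hgs]
    refine withDensity_congr_ae ?_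
    filter_upwards [ae_restrict_mem (measurableSet_singleton (0 : ℝ)).compl] with a ha
    have ha' : a ≠ 0 := ha
    simp [hDensity, ha', div_eq_mul_inv, mul_comm]

lemma measurable_hDensity (hg : Measurable (Function.uncurry g)) :
    Measurable fun p : ℝ × ℝ => hDensity G g p.1 p.2 := by
  unfold hDensity
  refine Measurable.ite (measurable_fst (measurableSet_singleton 0)) measurable_const ?_
  have : Measurable fun p : ℝ × ℝ => g p.2 p.1 := hg.comp measurable_swap
  fun_prop

lemma measurable_jumpWeight (hρ : Measurable (Function.uncurry ρ))
    (hg : Measurable (Function.uncurry g)) :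
    Measurable fun y : ((Fin M → ℝ) × Ω) × ℝ => jumpWeight G ρ M g y.1 y.2 := by
  unfold jumpWeight rhoM
  have h1 : Measurable fun y : ((Fin M → ℝ) × Ω) × ℝ => ρ y.2 y.1.2 :=
    hρ.comp (by fun_prop : Measurable fun y : ((Fin M → ℝ) × Ω) × ℝ => (y.2, y.1.2))
  have h2 : ∀ i, Measurable fun y : ((Fin M → ℝ) × Ω) × ℝ => hDensity G g (y.1.1 i) y.2 :=
    fun i => (measurable_hDensity hg).comp
      (by fun_prop : Measurable fun y : ((Fin M → ℝ) × Ω) × ℝ => (y.1.1 i, y.2))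
  fun_prop

lemma measurable_jumpWeight_right (hρ : Measurable (Function.uncurry ρ))
    (hg : Measurable (Function.uncurry g)) (x : (Fin M → ℝ) × Ω) :
    Measurable (jumpWeight G ρ M g x) := by
  have h1 : Measurable fun s => ρ s x.2 := hρ.comp measurable_prodMk_right
  have h2 : ∀ i, Measurable (hDensity G g (x.1 i)) :=
    fun i => (measurable_hDensity hg).comp measurable_prodMk_left
  have h3 : Measurable fun s => (1 - piA G s) ^ M * ρ s x.2 * ∏ i, hDensity G g (x.1 i) s := by
    fun_prop
  exact h3

lemma measurable_jumpNorm (hρ : Measurable (Function.uncurry ρ))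
    (hg : Measurable (Function.uncurry g)) :
    Measurable (jumpNorm (Ω := Ω) G ρ M g) :=
  (measurable_jumpWeight hρ hg).lintegral_prod_right'

end DensityBase

variable [IsMarkovKernel G]

section Atoms

variable [SFinite B0] [SFinite (levyMeasure ρ B0)]

lemma isFiniteMeasure_featureJump (hρ : Measurable (Function.uncurry ρ))
    (hG : ∀ᵐ p ∂(levyMeasure ρ B0), 0 < G p.1 {0}) (hΨ : Psi G ρ B0 M ≠ ∞) :
    IsFiniteMeasure (featureJump G ρ B0 M) :=
  ⟨by rw [featureJump_univ hρ hG]; exact hΨ.lt_top⟩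

/-- The $\omega$-coordinate of $\Lambda$ inherits the absence of atoms from $B_0$. -/
lemma featureMeasure_ae_ne [MeasurableSingletonClass Ω] [NullSingletonClass B0]
    (hρ : Measurable (Function.uncurry ρ))
    (hG : ∀ᵐ p ∂(levyMeasure ρ B0), 0 < G p.1 {0}) (c : Ω) :
    ∀ᵐ x ∂(featureMeasure G ρ B0 M), x.2 ≠ c := by
  have hc : MeasurableSet {x : (Fin M → ℝ) × Ω | x.2 ≠ c} :=
    (measurable_snd (measurableSet_singleton c)).compl
  have hν : ∀ᵐ p ∂(levyMeasure ρ B0), p.2 ≠ c := by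
    have hprod : ∀ᵐ p ∂((volume.restrict (Ioi (0 : ℝ))).prod B0), p.2 ≠ c := by
      rw [ae_iff]
      have : {p : ℝ × Ω | ¬p.2 ≠ c} = univ ×ˢ {c} := by ext p; simp
      rw [this, Measure.prod_prod, measure_singleton, mul_zero]
    exact (withDensity_absolutelyContinuous _ _).ae_le hprod
  have hc' : MeasurableSet {y : ((Fin M → ℝ) × Ω) × ℝ | y.1.2 ≠ c} := hc.preimage measurable_fst
  rw [featureMeasure, ae_map_iff measurable_fst.aemeasurable hc, featureJump_eq hρ hG,
    ae_map_iff (by fun_prop) hc']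
  refine ae_restrict_of_ae ?_
  have hc2 : MeasurableSet {q : (ℝ × Ω) × (Fin M → ℝ) | q.1.2 ≠ c} :=
    hc'.preimage (by fun_prop : Measurable fun q : (ℝ × Ω) × (Fin M → ℝ) => ((q.2, q.1.2), q.1.1))
  refine (Measure.ae_compProd_iff hc2).mpr ?_
  filter_upwards [hν] with p hp
  exact .of_forall fun _ => hp

end Atoms

/-- Independent points from a law without atoms in `ω` are distinct. -/
lemma pi_ae_mem_validTuples [StandardBorelSpace Ω] (L : Measure ((Fin M → ℝ) × Ω))
    [IsFiniteMeasure L] (h0 : ∀ᵐ x ∂L, x.1 ≠ 0) (h1 : ∀ c, ∀ᵐ x ∂L, x.2 ≠ c) (K : ℕ) :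
    ∀ᵐ x ∂(Measure.pi fun _ : Fin K => L), x ∈ validTuples Ω M K := by
  have hne : ∀ i j : Fin K, i ≠ j →
      ∀ᵐ x ∂(Measure.pi fun _ : Fin K => L), (x i).2 ≠ (x j).2 := by
    intro i j hij
    cases K with
    | zero => exact i.elim0
    | succ n =>
      -- Coordinate $i$ is split off: with the others fixed, a coincidence means that it hits one
      -- given point, which is a null event by `h1`.
      obtain ⟨j, rfl⟩ := Fin.exists_succAbove_eq hij.symm
      have hφ := measurableEmbedding_embeddingReal Ω
      have hmp := measurePreserving_piFinSuccAbove (fun _ : Fin (n + 1) => L) i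
      have hS : MeasurableSet {p : ((Fin M → ℝ) × Ω) × (Fin n → (Fin M → ℝ) × Ω) |
          p.1.2 = (p.2 j).2} := by
        have : {p : ((Fin M → ℝ) × Ω) × (Fin n → (Fin M → ℝ) × Ω) | p.1.2 = (p.2 j).2} =
            {p | embeddingReal Ω p.1.2 = embeddingReal Ω (p.2 j).2} := by
          ext p
          exact hφ.injective.eq_iff.symm
        rw [this]
        have := hφ.measurable
        exact measurableSet_eq_fun (by fun_prop) (by fun_prop)
      have hnull : (L.prod (Measure.pi fun _ : Fin n => L))
          {p | p.1.2 = (p.2 j).2} = 0 := by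
        rw [Measure.prod_apply_symm hS, lintegral_eq_zero_iff (measurable_measure_prodMk_right hS)]
        refine .of_forall fun r => ?_
        have := h1 (r j).2
        rw [ae_iff] at this
        simpa using this
      have hpre := hmp.measure_preimage hS.nullMeasurableSet
      rw [hnull] at hpre
      rw [ae_iff]
      convert hpre using 2
      ext x
      simp only [ne_eq, not_not]
      rfl
  have h0' : ∀ i : Fin K, ∀ᵐ x ∂(Measure.pi fun _ : Fin K => L), (x i).1 ≠ 0 := fun i =>
    (Measure.quasiMeasurePreserving_eval (fun _ : Fin K => L) i).ae h0
  have hne' : ∀ᵐ x ∂(Measure.pi fun _ : Fin K => L), ∀ i j, i ≠ j → (x i).2 ≠ (x j).2 := by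
    rw [ae_all_iff]
    intro i
    rw [ae_all_iff]
    intro j
    by_cases hij : i = j
    · simp [hij]
    · filter_upwards [hne i j hij] with x hx _
      exact hx
  filter_upwards [ae_all_iff.mpr h0', hne'] with x hx hx'
  exact ⟨hx, fun i j h => by_contra fun hij => hx' i j hij h⟩

section Density

variable {lam : Measure ℝ} {g : ℝ → ℝ → ℝ≥0∞}

lemma pi_hMeasure_eq_withDensity [SigmaFinite lam] (hg : Measurable (Function.uncurry g)) {s : ℝ}
    (h0 : 0 < G s {0})
    (hs : (G s).restrict {0}ᶜ = (lam.withDensity (g s)).restrict {0}ᶜ) :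
    (Measure.pi fun _ : Fin M => hMeasure G s) =
      (Measure.pi fun _ : Fin M => baseMeasure lam).withDensity
        fun a => ∏ i, hDensity G g (a i) s := by
  classical
  have := isFiniteMeasure_hMeasure h0
  have hh : Measurable fun a => hDensity G g a s :=
    (measurable_hDensity hg).comp measurable_prodMk_right
  refine Measure.pi_eq fun C hC => ?_
  rw [withDensity_apply _ (.univ_pi hC), ← lintegral_indicator (.univ_pi hC)]
  have hind : ∀ a : Fin M → ℝ, (univ.pi C).indicator (fun a => ∏ i, hDensity G g (a i) s) a =
      ∏ i, (C i).indicator (fun a => hDensity G g a s) (a i) := by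
    intro a
    by_cases ha : a ∈ univ.pi C
    · rw [indicator_of_mem ha]
      exact Finset.prod_congr rfl fun i _ => (indicator_of_mem (ha i (mem_univ i))
        fun a => hDensity G g a s).symm
    · rw [indicator_of_notMem ha]
      obtain ⟨i, hi⟩ : ∃ i, a i ∉ C i := by simpa [mem_univ_pi] using ha
      exact (Finset.prod_eq_zero (Finset.mem_univ i) (indicator_of_notMem hi _)).symm
  simp_rw [hind]
  rw [lintegral_pi_prod (fun _ : Fin M => baseMeasure lam)
    (f := fun i a => (C i).indicator (fun a => hDensity G g a s) a)
    fun i => hh.indicator (hC i)]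
  refine Finset.prod_congr rfl fun i _ => ?_
  rw [lintegral_indicator (hC i), hMeasure_eq_withDensity hg hs, withDensity_apply _ (hC i)]

variable [SFinite B0] [SFinite (levyMeasure ρ B0)] [SigmaFinite lam]

/-- `(δ₀ + λ|_{a ≠ 0})^M ⊗ B₀` on `a ≠ 0`. -/
def baseFeature (lam : Measure ℝ) (B0 : Measure Ω) (M : ℕ) : Measure ((Fin M → ℝ) × Ω) :=
  ((Measure.pi fun _ : Fin M => baseMeasure lam).prod B0).restrict {x | x.1 ≠ 0}

instance : SFinite (baseFeature lam B0 M) := by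
  unfold baseFeature
  infer_instance

/-- Starting from $\nu\otimes G_A^{\otimes M}$ on $a\ne0$, the marks are written as
$[1-\pi_A]^M\prod_ih_i$ against the base measure, the density $\rho$ is pulled inside, and Tonelli
moves the $s$-integral innermost. -/
lemma lintegral_featureJump_density (hρ : Measurable (Function.uncurry ρ))
    (hG : ∀ᵐ p ∂(levyMeasure ρ B0), 0 < G p.1 {0})
    (hg : IsMarkDensity G (levyMeasure ρ B0) lam g)
    {f : ((Fin M → ℝ) × Ω) × ℝ → ℝ≥0∞} (hf : Measurable f) :
    ∫⁻ y, f y ∂(featureJump G ρ B0 M) =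
      ∫⁻ x, (∫⁻ s in Ioi (0 : ℝ), jumpWeight G ρ M g x s * f (x, s)) ∂(baseFeature lam B0 M) := by
  have hne : MeasurableSet {x : (Fin M → ℝ) × Ω | x.1 ≠ 0} :=
    (measurable_fst (measurableSet_singleton 0)).compl
  have hW := measurable_jumpWeight (M := M) (G := G) hρ hg.1
  have hWf : Measurable fun y : ((Fin M → ℝ) × Ω) × ℝ => jumpWeight G ρ M g y.1 y.2 * f y :=
    hW.mul hf
  let F : (ℝ × Ω) × (Fin M → ℝ) → ℝ≥0∞ := fun q => f ((q.2, q.1.2), q.1.1)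
  have hF : Measurable F := by fun_prop
  let H : (ℝ × Ω) × (Fin M → ℝ) → ℝ≥0∞ := fun q => {x : (Fin M → ℝ) × Ω | x.1 ≠ 0}.indicator
    (fun x => jumpWeight G ρ M g x q.1.1 * f (x, q.1.1)) (q.2, q.1.2)
  have hH : Measurable H := by
    have : H = ({q : (ℝ × Ω) × (Fin M → ℝ) | q.2 ≠ 0}).indicator
        ((fun y : ((Fin M → ℝ) × Ω) × ℝ => jumpWeight G ρ M g y.1 y.2 * f y) ∘
          fun q : (ℝ × Ω) × (Fin M → ℝ) => ((q.2, q.1.2), q.1.1)) := rfl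
    rw [this]
    exact (hWf.comp (by fun_prop)).indicator measurableSet_marked_ne_zero
  have hin : Measurable fun p : ℝ × Ω =>
      ∫⁻ a, H (p, a) ∂(Measure.pi fun _ : Fin M => baseMeasure lam) :=
    hH.lintegral_prod_right'
  calc ∫⁻ y, f y ∂(featureJump G ρ B0 M)
      = ∫⁻ p, ∫⁻ a, {q : (ℝ × Ω) × (Fin M → ℝ) | q.2 ≠ 0}.indicator F (p, a)
          ∂(markKernel G M p) ∂(levyMeasure ρ B0) := by
        rw [← Measure.lintegral_compProd (hF.indicator measurableSet_marked_ne_zero),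
          lintegral_indicator measurableSet_marked_ne_zero, ← lintegral_featureJump hρ hG hF]
        rfl
    _ = ∫⁻ p, (∫⁻ a, {q : (ℝ × Ω) × (Fin M → ℝ) | q.2 ≠ 0}.indicator
          (fun q => (G q.1.1 {0}) ^ M * (∏ i, hDensity G g (q.2 i) q.1.1) * F q) (p, a)
          ∂(Measure.pi fun _ : Fin M => baseMeasure lam)) ∂(levyMeasure ρ B0) := by
        refine lintegral_congr_ae ?_
        filter_upwards [hG, hg.2] with p hp hgp
        have hGpi : markKernel G M p = (G p.1 {0}) ^ M •
            (Measure.pi fun _ : Fin M => baseMeasure lam).withDensity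
              fun a => ∏ i, hDensity G g (a i) p.1 := by
          rw [← pi_hMeasure_eq_withDensity hg.1 hp hgp, pi_hMeasure hp, smul_smul,
            ENNReal.mul_inv_cancel (pow_ne_zero _ hp.ne')
              (ENNReal.pow_ne_top (measure_ne_top _ _)), one_smul, markKernel_apply]
        have hprod : Measurable fun a : Fin M → ℝ => ∏ i, hDensity G g (a i) p.1 :=
          Finset.measurable_prod _ fun i _ => (measurable_hDensity hg.1).comp
            (by fun_prop : Measurable fun a : Fin M → ℝ => (a i, p.1))
        have hFp : Measurable fun a : Fin M → ℝ =>
            {q : (ℝ × Ω) × (Fin M → ℝ) | q.2 ≠ 0}.indicator F (p, a) :=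
          (hF.indicator measurableSet_marked_ne_zero).comp measurable_prodMk_left
        rw [hGpi, lintegral_smul_measure, lintegral_withDensity_eq_lintegral_mul _ hprod hFp,
          smul_eq_mul, ← lintegral_const_mul _ (hprod.mul hFp)]
        refine lintegral_congr fun a => ?_
        by_cases ha : a = 0 <;> simp [ha, mul_assoc]
    _ = ∫⁻ p, ∫⁻ a, H (p, a) ∂(Measure.pi fun _ : Fin M => baseMeasure lam)
          ∂((volume.restrict (Ioi (0 : ℝ))).prod B0) := by
        have hm : Measurable fun q : (ℝ × Ω) × (Fin M → ℝ) =>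
            (G q.1.1 {0}) ^ M * (∏ i, hDensity G g (q.2 i) q.1.1) * F q := by
          have : ∀ i, Measurable fun q : (ℝ × Ω) × (Fin M → ℝ) => hDensity G g (q.2 i) q.1.1 :=
            fun i => (measurable_hDensity hg.1).comp
              (by fun_prop : Measurable fun q : (ℝ × Ω) × (Fin M → ℝ) => (q.2 i, q.1.1))
          have h0 : Measurable fun q : (ℝ × Ω) × (Fin M → ℝ) => G q.1.1 {0} :=
            measurable_mass_zero.comp (by fun_prop)
          fun_prop
        have hm' := hm.indicator measurableSet_marked_ne_zero
        rw [levyMeasure, lintegral_withDensity_eq_lintegral_mul _ (by exact hρ)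
          (hm'.lintegral_prod_right')]
        refine lintegral_congr fun p => ?_
        rw [Pi.mul_apply, ← lintegral_const_mul _ (by exact hm'.comp measurable_prodMk_left)]
        refine lintegral_congr fun a => ?_
        by_cases ha : a = 0
        · simp [H, ha]
        · simp only [H, F, mem_ofPred_eq, ne_eq, ha, not_false_eq_true, indicator_of_mem,
            jumpWeight, rhoM, one_sub_piA]
          ring
    _ = ∫⁻ s in Ioi 0, ∫⁻ ω, ∫⁻ a, H ((s, ω), a)
          ∂(Measure.pi fun _ : Fin M => baseMeasure lam) ∂B0 :=
        lintegral_prod _ hin.aemeasurable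
    _ = ∫⁻ s in Ioi 0, ∫⁻ x, {x : (Fin M → ℝ) × Ω | x.1 ≠ 0}.indicator
          (fun x => jumpWeight G ρ M g x s * f (x, s)) x
          ∂((Measure.pi fun _ : Fin M => baseMeasure lam).prod B0) := by
        refine lintegral_congr fun s => ?_
        rw [lintegral_prod_symm _ (by
          exact ((hWf.comp measurable_prodMk_right).indicator hne).aemeasurable)]
    _ = ∫⁻ s in Ioi 0, ∫⁻ x, jumpWeight G ρ M g x s * f (x, s) ∂(baseFeature lam B0 M) := by
        refine lintegral_congr fun s => ?_
        rw [lintegral_indicator hne, baseFeature]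
    _ = _ := lintegral_lintegral_swap (by
        exact (hWf.comp (by fun_prop : Measurable fun z : ℝ × ((Fin M → ℝ) × Ω) =>
          (z.2, z.1))).aemeasurable)

lemma featureMeasure_eq_withDensity (hρ : Measurable (Function.uncurry ρ))
    (hG : ∀ᵐ p ∂(levyMeasure ρ B0), 0 < G p.1 {0})
    (hg : IsMarkDensity G (levyMeasure ρ B0) lam g) :
    featureMeasure G ρ B0 M = (baseFeature lam B0 M).withDensity (jumpNorm G ρ M g) := by
  have hW := measurable_jumpWeight (M := M) (G := G) hρ hg.1
  refine Measure.ext_of_lintegral _ fun f hf => ?_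
  rw [featureMeasure, lintegral_map hf measurable_fst, lintegral_featureJump_density hρ hG hg
    (f := fun y => f y.1) (by fun_prop),
    lintegral_withDensity_eq_lintegral_mul _ (measurable_jumpNorm hρ hg.1) hf]
  refine lintegral_congr fun x => ?_
  have hWx := measurable_jumpWeight_right (G := G) hρ hg.1 x
  rw [Pi.mul_apply, jumpNorm, ← lintegral_mul_const (f x) hWx]

lemma isProbabilityMeasure_withDensity_div {α : Type*} [MeasurableSpace α] {m : Measure α}
    {u : α → ℝ≥0∞} (hu : Measurable u) (h0 : ∫⁻ s, u s ∂m ≠ 0) (htop : ∫⁻ s, u s ∂m ≠ ∞) :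
    IsProbabilityMeasure (m.withDensity fun s => u s / ∫⁻ t, u t ∂m) := by
  refine ⟨?_⟩
  simp_rw [withDensity_apply _ .univ, setLIntegral_univ, div_eq_mul_inv]
  rw [lintegral_mul_const _ hu, ENNReal.mul_inv_cancel h0 htop]

open Classical in
/-- The jump laws are the normalized densities. -/
lemma jumpLaw_ae_eq (hρ : Measurable (Function.uncurry ρ))
    (hG : ∀ᵐ p ∂(levyMeasure ρ B0), 0 < G p.1 {0}) (hΨ : Psi G ρ B0 M ≠ ∞)
    (hg : IsMarkDensity G (levyMeasure ρ B0) lam g)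
    {J : Kernel ((Fin M → ℝ) × Ω) ℝ} [IsMarkovKernel J] (hJ : IsJumpLaw G ρ B0 M J) :
    ∀ᵐ x ∂(featureMeasure G ρ B0 M), jumpNorm G ρ M g x ≠ 0 ∧ jumpNorm G ρ M g x ≠ ∞ ∧
      J x = (volume.restrict (Ioi (0 : ℝ))).withDensity fun s =>
        jumpWeight G ρ M g x s / jumpNorm G ρ M g x := by
  have hΛ := isFiniteMeasure_featureJump hρ hG hΨ
  have hL : IsFiniteMeasure (featureMeasure G ρ B0 M) := by
    rw [featureMeasure]
    infer_instance
  have hW := measurable_jumpWeight (M := M) (G := G) hρ hg.1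
  have hn := measurable_jumpNorm (M := M) (G := G) hρ hg.1
  have hLD := featureMeasure_eq_withDensity (M := M) hρ hG hg
  have h0 : ∀ᵐ x ∂(featureMeasure G ρ B0 M), jumpNorm G ρ M g x ≠ 0 := by
    rw [hLD, ae_withDensity_iff hn]
    exact .of_forall fun x hx => hx
  -- The normalizing integral is the density of the finite measure $L$ with respect to the base
  -- measure, hence finite almost everywhere; it is positive $L$-almost everywhere because its zero
  -- set is $L$-null.
  have htopD : ∀ᵐ x ∂(baseFeature lam B0 M), jumpNorm G ρ M g x ≠ ∞ := by
    have hfin : ∫⁻ x, jumpNorm G ρ M g x ∂(baseFeature lam B0 M) ≠ ∞ := by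
      rw [← setLIntegral_univ, ← withDensity_apply _ .univ, ← hLD]
      exact measure_ne_top _ _
    filter_upwards [ae_lt_top hn hfin] with x hx
    exact hx.ne
  have htop : ∀ᵐ x ∂(featureMeasure G ρ B0 M), jumpNorm G ρ M g x ≠ ∞ := by
    rw [hLD]
    exact (withDensity_absolutelyContinuous _ _).ae_le htopD
  let T : Set ((Fin M → ℝ) × Ω) := {x | jumpNorm G ρ M g x ≠ 0 ∧ jumpNorm G ρ M g x ≠ ∞}
  have hT : MeasurableSet T :=
    (hn (measurableSet_singleton 0)).compl.inter (hn (measurableSet_singleton ∞)).compl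
  let D : (Fin M → ℝ) × Ω → Measure ℝ := fun x => (volume.restrict (Ioi (0 : ℝ))).withDensity
    fun s => jumpWeight G ρ M g x s / jumpNorm G ρ M g x
  have hWn : Measurable fun y : ((Fin M → ℝ) × Ω) × ℝ =>
      jumpWeight G ρ M g y.1 y.2 / jumpNorm G ρ M g y.1 := by fun_prop
  have hD : Measurable D := by
    refine Measure.measurable_of_measurable_coe _ fun C hC => ?_
    simp_rw [D, withDensity_apply _ hC, ← lintegral_indicator hC]
    exact (hWn.indicator (hC.preimage measurable_snd)).lintegral_prod_right'
  -- The Dirac value outside `T` only serves to make `J'` a Markov kernel; `T` has full $L$-measure.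
  let J' : Kernel ((Fin M → ℝ) × Ω) ℝ :=
    ⟨T.piecewise D fun _ => Measure.dirac 0, hD.piecewise hT measurable_const⟩
  have hJ'T : ∀ x ∈ T, J' x = D x := fun x hx =>
    piecewise_eq_of_mem T D (fun _ => Measure.dirac 0) hx
  have hJ' : IsMarkovKernel J' := by
    refine ⟨fun x => ?_⟩
    by_cases hx : x ∈ T
    · rw [hJ'T x hx]
      have hWx := measurable_jumpWeight_right (G := G) hρ hg.1 x
      change IsProbabilityMeasure ((volume.restrict (Ioi (0 : ℝ))).withDensity fun s =>
        jumpWeight G ρ M g x s / jumpNorm G ρ M g x)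
      exact isProbabilityMeasure_withDensity_div hWx hx.1 hx.2
    · have : J' x = Measure.dirac 0 := 
        piecewise_eq_of_notMem T D (fun _ => Measure.dirac 0) hx
      rw [this]
      infer_instance
  have hcomp : featureMeasure G ρ B0 M ⊗ₘ J = featureMeasure G ρ B0 M ⊗ₘ J' := by
    rw [← hJ]
    refine Measure.ext_of_lintegral _ fun f hf => ?_
    rw [lintegral_featureJump_density hρ hG hg hf, Measure.lintegral_compProd hf, hLD,
      lintegral_withDensity_eq_lintegral_mul _ hn hf.lintegral_kernel_prod_right']
    refine lintegral_congr_ae ?_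
    filter_upwards [htopD] with x hx
    rw [Pi.mul_apply]
    -- A zero normalizing integral forces the weight to vanish for almost every $s$, so both sides
    -- are zero; otherwise normalization cancels.
    by_cases hx0 : jumpNorm G ρ M g x = 0
    · have hz : ∀ᵐ s ∂(volume.restrict (Ioi (0 : ℝ))), jumpWeight G ρ M g x s = 0 :=
        (lintegral_eq_zero_iff (measurable_jumpWeight_right hρ hg.1 x)).mp hx0
      rw [hx0, zero_mul]
      refine (lintegral_congr_ae ?_).trans lintegral_zero
      filter_upwards [hz] with s hs
      simp [hs]
    · have hWx : Measurable fun s => jumpWeight G ρ M g x s / jumpNorm G ρ M g x :=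
        (measurable_jumpWeight_right (G := G) hρ hg.1 x).div_const _
      have hfx : Measurable fun s => f (x, s) := hf.comp measurable_prodMk_left
      have hx' : J' x = (volume.restrict (Ioi (0 : ℝ))).withDensity fun s =>
        jumpWeight G ρ M g x s / jumpNorm G ρ M g x := hJ'T x ⟨hx0, hx⟩
      rw [hx', lintegral_withDensity_eq_lintegral_mul _ hWx hfx,
        ← lintegral_const_mul _ (hWx.mul hfx)]
      refine lintegral_congr fun s => ?_
      rw [Pi.mul_apply, ← mul_assoc, ENNReal.mul_div_cancel hx0 hx]
  -- Two disintegrations of the same finite measure agree $L$-almost everywhere.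
  have hae := Kernel.ae_eq_of_compProd_eq hcomp
  filter_upwards [h0, htop, hae] with x hx0 hxt hx
  exact ⟨hx0, hxt, by rw [hx, hJ'T x ⟨hx0, hxt⟩]⟩

end Density

end

/-! ### Conditional laws and the theorem -/

section


variable {S Ω : Type*} [MeasurableSpace S] [MeasurableSpace Ω] {P : Measure S} {B0 : Measure Ω}
  {ρ : ℝ → Ω → ℝ≥0∞} {G : Kernel ℝ ℝ} {M : ℕ}

/-- A finite measure disintegrates over its marginal because the jump coordinate lives in the
standard Borel space $\mathbb R$. -/
lemma exists_isJumpLaw [IsFiniteMeasure (featureJump G ρ B0 M)] :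
    ∃ J : Kernel ((Fin M → ℝ) × Ω) ℝ, IsMarkovKernel J ∧ IsJumpLaw G ρ B0 M J :=
  ⟨(featureJump G ρ B0 M).condKernel, inferInstance,
    ((featureJump G ρ B0 M).disintegrate (featureJump G ρ B0 M).condKernel).symm⟩

variable [StandardBorelSpace Ω] [IsMarkovKernel G]

section Joint

variable [SFinite B0] [SigmaFinite (levyMeasure ρ B0)]
  {J : Kernel ((Fin M → ℝ) × Ω) ℝ} [IsMarkovKernel J]
  {τ : ℕ → S → ℝ} {w : ℕ → S → Ω} {A : Fin M → ℕ → S → ℝ}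
  {N : S → Measure (ℝ × Ω)} {μ : S → Measure Ω} {Z : Fin M → S → SignedMeasure Ω}

variable [IsProbabilityMeasure P]

/-- In the first marginal of the joint law the unmarked points and the jumps integrate out to total
mass $1$, leaving $L^{\otimes K}$ for each $K$. -/
lemma IsIBPModel.map_Z (h : IsIBPModel P G (levyMeasure ρ B0) M τ w A N μ Z)
    [IsFiniteMeasure (featureMeasure G ρ B0 M)] (hJ : IsJumpLaw G ρ B0 M J)
    (hρ : Measurable (Function.uncurry ρ)) (hG : ∀ᵐ p ∂(levyMeasure ρ B0), 0 < G p.1 {0})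
    (hΨ : Psi G ρ B0 M ≠ ∞) :
    P.map (fun s i => Z i s) = marginalZ G ρ B0 M := by
  have := h.isProbabilityMeasure_unmarkedLaw
  have hZN : Measurable fun s => ((fun i => Z i s), N s) :=
    (measurable_pi_lambda _ h.measurable_Z).prodMk h.isPRM.measurable
  have hfst : P.map (fun s i => Z i s) = (P.map fun s => ((fun i => Z i s), N s)).map Prod.fst := by
    rw [Measure.map_map measurable_fst hZN]
    rfl
  rw [hfst, h.map_Z_N hρ hG hΨ, marginalZ, Measure.map_smul,
    Measure.map_sum measurable_fst.aemeasurable]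
  congr 2
  funext K
  rw [Measure.map_smul, hJ, map_fst_observe]

variable [NullSingletonClass B0]

lemma marginalZ_ae_mem_observedSet [IsFiniteMeasure (featureMeasure G ρ B0 M)]
    (hρ : Measurable (Function.uncurry ρ)) (hG : ∀ᵐ p ∂(levyMeasure ρ B0), 0 < G p.1 {0}) :
    ∀ᵐ z ∂(marginalZ G ρ B0 M), z ∈ ⋃ K, observedSet Ω M K := by
  have hV : MeasurableSet {z | z ∈ ⋃ K, observedSet Ω M K} :=
    MeasurableSet.iUnion fun K => measurableSet_observedSet
  refine Measure.ae_smul_measure ?_ _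
  rw [Measure.ae_sum_iff' hV]
  refine fun K => Measure.ae_smul_measure ?_ _
  rw [ae_map_iff (measurable_assemble M K).aemeasurable hV]
  filter_upwards [pi_ae_mem_validTuples (featureMeasure G ρ B0 M) featureMeasure_ae_ne_zero
    (featureMeasure_ae_ne hρ hG) K] with x hx
  exact mem_iUnion_of_mem K (assemble_mem_observedSet hx)

/-- The same kernel $\kappa$ serves for every $K$, so the composition-product identity for fixed $K$
passes to the weighted sum. -/
lemma IsIBPModel.hasCondDistrib_N (h : IsIBPModel P G (levyMeasure ρ B0) M τ w A N μ Z)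
    [IsFiniteMeasure (featureMeasure G ρ B0 M)] (hJ : IsJumpLaw G ρ B0 M J)
    (hρ : Measurable (Function.uncurry ρ)) (hG : ∀ᵐ p ∂(levyMeasure ρ B0), 0 < G p.1 {0})
    (hΨ : Psi G ρ B0 M ≠ ∞)
    {κ : Kernel (Fin M → SignedMeasure Ω) (Measure (ℝ × Ω))} [IsMarkovKernel κ]
    (hκ : ∀ z ∈ ⋃ K, observedSet Ω M K, κ z = posteriorN (unmarkedLaw P τ w A) J z) :
    HasCondDistrib N (fun s i => Z i s) κ P := by
  have := h.isProbabilityMeasure_unmarkedLaw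
  have hZN : Measurable fun s => ((fun i => Z i s), N s) :=
    (measurable_pi_lambda _ h.measurable_Z).prodMk h.isPRM.measurable
  refine ⟨hZN.aemeasurable, ?_⟩
  rw [h.map_Z hJ hρ hG hΨ, h.map_Z_N hρ hG hΨ, marginalZ, Measure.compProd_smul_left,
    Measure.compProd_sum_left]
  congr 2
  funext K
  rw [Measure.compProd_smul_left]
  congr 1
  rw [hJ]
  exact map_observe_eq_compProd _ _ (pi_ae_mem_validTuples _ featureMeasure_ae_ne_zero
    (featureMeasure_ae_ne hρ hG) K) hκ

end Joint

end

end LatentFeature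

end

theorem theorem2p1 {S Ω : Type*} [MeasurableSpace S] [MeasurableSpace Ω] [StandardBorelSpace Ω]
    (P : Measure S) [IsProbabilityMeasure P]
    (B0 : Measure Ω) [IsProbabilityMeasure B0] [NullSingletonClass B0]
    (ρ : ℝ → Ω → ℝ≥0∞) (hρ_meas : Measurable (Function.uncurry ρ))
    (hρ : ∀ᵐ ω ∂B0, ∫⁻ s in Ioi (0 : ℝ), ENNReal.ofReal (min s 1) * ρ s ω ≠ ∞)
    (G : Kernel ℝ ℝ) [IsMarkovKernel G]
    (hG : ∀ᵐ p ∂(LatentFeature.levyMeasure ρ B0), 0 < G p.1 {0})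
    (M : ℕ) (hΨ : LatentFeature.Psi G ρ B0 M ≠ ∞)
    (τ : ℕ → S → ℝ) (w : ℕ → S → Ω) (A : Fin M → ℕ → S → ℝ)
    (N : S → Measure (ℝ × Ω)) (μ : S → Measure Ω) (Z : Fin M → S → SignedMeasure Ω)
    (hmodel : LatentFeature.IsIBPModel P G (LatentFeature.levyMeasure ρ B0) M τ w A N μ Z) :
    -- the observed features are finite in number
    (∀ᵐ s ∂P, (LatentFeature.features fun i => Z i s).Finite) ∧
    -- `R` is the law of `N_M`, and `J` gives the laws of the jumps
    (∃ R : Measure (Measure (ℝ × Ω)), IsProbabilityMeasure R ∧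
      LatentFeature.IsPRM R id (LatentFeature.levyMeasure (LatentFeature.rhoM G ρ M) B0) ∧
      ∃ J : Kernel ((Fin M → ℝ) × Ω) ℝ, ∃ _ : IsMarkovKernel J,
        LatentFeature.IsJumpLaw G ρ B0 M J ∧
        -- the jumps have the normalized density, whenever `G` has a density off `0`
        (∀ (lam : Measure ℝ) (_ : SigmaFinite lam) (g : ℝ → ℝ → ℝ≥0∞),
          LatentFeature.IsMarkDensity G (LatentFeature.levyMeasure ρ B0) lam g →
          ∀ᵐ x ∂(LatentFeature.featureMeasure G ρ B0 M),
            LatentFeature.jumpNorm G ρ M g x ≠ 0 ∧ LatentFeature.jumpNorm G ρ M g x ≠ ∞ ∧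
            J x = (volume.restrict (Ioi (0 : ℝ))).withDensity fun s =>
              LatentFeature.jumpWeight G ρ M g x s / LatentFeature.jumpNorm G ρ M g x) ∧
        -- (i)
        LatentFeature.IsPosterior P N (fun s i => Z i s) (LatentFeature.posteriorN R J) ∧
        -- (ii)
        LatentFeature.IsPosterior P μ (fun s i => Z i s)
          (LatentFeature.posteriorμ (R.map LatentFeature.crmOf) J)) ∧
    -- (iii)
    P.map (fun s i => Z i s) = LatentFeature.marginalZ G ρ B0 M ∧
    (∀ (lam : Measure ℝ) (_ : SigmaFinite lam) (g : ℝ → ℝ → ℝ≥0∞),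
      LatentFeature.IsMarkDensity G (LatentFeature.levyMeasure ρ B0) lam g →
      LatentFeature.featureMeasure G ρ B0 M =
        (((Measure.pi fun _ : Fin M => Measure.dirac (0 : ℝ) + lam.restrict {0}ᶜ).prod
          B0).withDensity (LatentFeature.jumpNorm G ρ M g)).restrict {x | x.1 ≠ 0}) := by
  have := LatentFeature.sigmaFinite_levyMeasure hρ_meas hρ
  have := LatentFeature.isFiniteMeasure_featureJump (M := M) hρ_meas hG hΨ
  have : IsFiniteMeasure (LatentFeature.featureMeasure G ρ B0 M) := by
    rw [LatentFeature.featureMeasure]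
    infer_instance
  have := hmodel.isProbabilityMeasure_unmarkedLaw
  obtain ⟨J, hJm, hJ⟩ := LatentFeature.exists_isJumpLaw (G := G) (ρ := ρ) (B0 := B0) (M := M)
  obtain ⟨κ, hκm, hκ⟩ :=
    LatentFeature.exists_posteriorKernel (LatentFeature.unmarkedLaw P τ w A) J
  have hZ : Measurable fun s i => Z i s := measurable_pi_lambda _ hmodel.measurable_Z
  have hmap := hmodel.map_Z hJ hρ_meas hG hΨ
  have hobs : ∀ᵐ z ∂(P.map fun s i => Z i s), z ∈ ⋃ K, LatentFeature.observedSet Ω M K := by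
    rw [hmap]
    exact LatentFeature.marginalZ_ae_mem_observedSet hρ_meas hG
  have hfin : ∀ z ∈ ⋃ K, LatentFeature.observedSet Ω M K, (LatentFeature.features z).Finite := by
    intro z hz
    obtain ⟨K, hK⟩ := mem_iUnion.mp hz
    exact LatentFeature.finite_features_of_mem hK
  have hN := hmodel.hasCondDistrib_N hJ hρ_meas hG hΨ hκ
  -- As $\mu$ is a measurable function of $N$, its conditional law is the pushforward of that of
  -- $N$.
  have hμ : μ = LatentFeature.crmOf ∘ N := funext hmodel.μ_eq
  refine ⟨?_, ⟨LatentFeature.unmarkedLaw P τ w A, inferInstance,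
    hmodel.isPRM_unmarkedLaw hρ_meas, J, hJm, hJ, fun lam _ g hg =>
      LatentFeature.jumpLaw_ae_eq hρ_meas hG hΨ hg hJ, ⟨κ, hκm, ?_, hN⟩,
    ⟨κ.map LatentFeature.crmOf, Kernel.IsMarkovKernel.map _ LatentFeature.measurable_crmOf, ?_,
      hμ ▸ hN.comp_left LatentFeature.measurable_crmOf⟩⟩, hmap, fun lam _ g hg => ?_⟩
  · filter_upwards [ae_of_ae_map hZ.aemeasurable hobs] with s hs
    exact hfin _ hs
  · filter_upwards [hobs] with z hz
    exact hκ z hz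
  · filter_upwards [hobs] with z hz
    rw [Kernel.map_apply _ LatentFeature.measurable_crmOf, hκ z hz,
      LatentFeature.posteriorμ_eq _ (hfin z hz)]
  · have hne : MeasurableSet {x : (Fin M → ℝ) × Ω | x.1 ≠ 0} :=
      (measurable_fst (measurableSet_singleton 0)).compl
    rw [restrict_withDensity hne]
    exact LatentFeature.featureMeasure_eq_withDensity hρ_meas hG hg
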